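/- Let $c>0$, $\lambda_1,\lambda_2>0$, and let $X_1(t),X_2(t)$, $t\ge 0$, be two independent telegraph processes on the real line, both with speed $c$, with rates $\lambda_1$ and $\lambda_2$ respectively. (A telegraph process with speed $c$ and rate $\lambda$ is the position at time $t$ of a particle which starts from the origin at time $0$, takes the positive or the negative initial direction with probability $1/2$ each, moves with constant speed $c$, and reverses its direction at every event of a homogeneous Poisson process of rate $\lambda$ that is independent of the initial direction.) Let $\rho(t)=|X_1(t)-X_2(t)|$. Then, for every $t>0$ and $r\in\mathbb R$, $$\Pr\{\rho(t)<r\}=\begin{cases}0, & r\in(-\infty,0],\\ H(r,t), & r\in(0,2ct],\\ 1, & r\in(2ct,+\infty),\end{cases}$$ where $$\begin{aligned}H(r,t)={}&\tfrac12\Big[(1-e^{-\lambda_1t})e^{-\lambda_2t}+e^{-\lambda_1t}(1-e^{-\lambda_2t})+e^{-(\lambda_1+\lambda_2)t}\Big]\\&-e^{-(\lambda_1+\lambda_2)t}\Big(1-\frac r{ct}\Big)\sum_{k=0}^\infty\frac1{(k!)^2}\Big[\Big(\frac{\lambda_1t}2\Big)^{2k+1}\Big(1+\frac{\lambda_1t}{2k+2}\Big)+\Big(\frac{\lambda_2t}2\Big)^{2k+1}\Big(1+\frac{\lambda_2t}{2k+2}\Big)\Big]F\Big(-k,\frac12;\frac32;\Big(1-\frac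 r{ct}\Big)^2\Big)\\&+e^{-\lambda_1t}\,\frac{\lambda_1}{2c}\sum_{k=0}^\infty\frac1{(k!)^2}\Big(\frac{\lambda_1t}2\Big)^{2k}\Big(1+\frac{\lambda_1t}{2k+2}\Big)\mathcal J_k(r,t),\end{aligned}$$ $$\begin{aligned}\mathcal J_k(r,t)=\frac{\lambda_2e^{-\lambda_2t}}{2c}\int_{-ct}^{ct}&\Big[\beta(x,r)F\Big(-k,\frac12;\frac32;\frac{\beta(x,r)^2}{c^2t^2}\Big)-\alpha(x,r)F\Big(-k,\frac12;\frac32;\frac{\alpha(x,r)^2}{c^2t^2}\Big)\Big]\\&\times\Big[I_0\Big(\frac{\lambda_2}c\sqrt{c^2t^2-x^2}\Big)+\frac{ct}{\sqrt{c^2t^2-x^2}}I_1\Big(\frac{\lambda_2}c\sqrt{c^2t^2-x^2}\Big)\Big]dx,\end{aligned}$$ $\alpha(x,r)=\max\{-ct,\,x-r\}$, $\beta(x,r)=\min\{ct,\,x+r\}$, $F={}_2F_1$ is the Gauss hypergeometric function, and $I_0(z)=\sum_{k\ge0}\frac{1}{(k!)^2}(z/2)^{2k}$, $I_1(z)=\sum_{k\ge0}\frac{1}{k!\,(k+1)!}(z/2)^{2k+1}$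 are the modified Bessel functions. For $r\in(0,2ct]$ the two series over $k$ converge and the integrals $\mathcal J_k(r,t)$ exist. -/

import Mathlib

open MeasureTheory ProbabilityTheory
open scoped NNReal

noncomputable section

namespace Telegraph

/-- `N` is a homogeneous Poisson process of rate `lam` under `μ`: it starts from `0`, almost all of
its paths are nondecreasing and right-continuous, it has independent increments, and for `s ≤ t`
the increment `N t - N s` has the Poisson law of parameter `lam * (t - s)`. (The truncated
subtraction in `ℕ` is harmless because almost all paths are nondecreasing.) -/
structure IsPoissonProcess {Ω : Type*} [MeasurableSpace Ω] (lam : ℝ≥0) (N : ℝ≥0 → Ω → ℕ)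
    (μ : Measure Ω) : Prop where
  measurable : ∀ t, Measurable (N t)
  zero : ∀ᵐ ω ∂μ, N 0 ω = 0
  monotone : ∀ᵐ ω ∂μ, Monotone (fun t => N t ω)
  rightContinuous : ∀ᵐ ω ∂μ, ∀ t, ContinuousWithinAt (fun s => N s ω) (Set.Ici t) t
  indepIncrements : HasIndepIncrements N μ
  law : ∀ s t, s ≤ t → HasLaw (fun ω => N t ω - N s ω) (poissonMeasure (lam * (t - s))) μ

/-- `X` is a telegraph process on the line with speed `c` and rate `lam`: the particle starts from
the origin, its initial direction `D` is `1` or `-1` with probability `1/2` each, and the direction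
is reversed at every event of a homogeneous Poisson process `N` of rate `lam`, independent of `D`.
So the velocity at time `s` is `c * D * (-1) ^ N s`, and the position is its integral. -/
def IsTelegraphProcess {Ω : Type*} [MeasurableSpace Ω] (c : ℝ) (lam : ℝ≥0) (X : ℝ≥0 → Ω → ℝ)
    (μ : Measure Ω) : Prop :=
  ∃ (D : Ω → ℝ) (N : ℝ≥0 → Ω → ℕ),
    Measurable D ∧
    μ {ω | D ω = 1} = 1 / 2 ∧
    μ {ω | D ω = -1} = 1 / 2 ∧
    IsPoissonProcess lam N μ ∧
    IndepFun D (fun ω s => N s ω) μ ∧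
    ∀ᵐ ω ∂μ, ∀ t : ℝ≥0,
      X t ω = ∫ s in (0 : ℝ)..(t : ℝ), c * D ω * (-1 : ℝ) ^ (N s.toNNReal ω)

/-- The distribution function `Pr {|X₁(t) - X₂(t)| < r}` (with strict inequality) of the distance
of two real processes. -/
def distanceCDF {Ω : Type*} [MeasurableSpace Ω] (μ : Measure Ω) (X₁ X₂ : ℝ≥0 → Ω → ℝ)
    (r : ℝ) (t : ℝ≥0) : ℝ :=
  μ.real {ω | |X₁ t ω - X₂ t ω| < r}

/-- The modified Bessel function of order zero. -/
def besselI0 (z : ℝ) : ℝ :=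
  ∑' k : ℕ, 1 / (k.factorial : ℝ) ^ 2 * (z / 2) ^ (2 * k)

/-- The modified Bessel function of order one. -/
def besselI1 (z : ℝ) : ℝ :=
  ∑' k : ℕ, 1 / ((k.factorial : ℝ) * ((k + 1).factorial : ℝ)) * (z / 2) ^ (2 * k + 1)

/-- The Gauss hypergeometric polynomial `F(-k, 1/2; 3/2; z)`. -/
def hyp (k : ℕ) (z : ℝ) : ℝ :=
  ordinaryHypergeometric (-(k : ℝ)) (1 / 2 : ℝ) (3 / 2 : ℝ) z

/-- `α(x, r) = max {-ct, x - r}`. -/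
def alpha (c t x r : ℝ) : ℝ := max (-(c * t)) (x - r)

/-- `β(x, r) = min {ct, x + r}`. -/
def beta (c t x r : ℝ) : ℝ := min (c * t) (x + r)

/-- The integrand of `J_k(r, t)`. -/
def integrandJ (c lam₂ : ℝ) (k : ℕ) (r t x : ℝ) : ℝ :=
  (beta c t x r * hyp k ((beta c t x r) ^ 2 / (c ^ 2 * t ^ 2))
      - alpha c t x r * hyp k ((alpha c t x r) ^ 2 / (c ^ 2 * t ^ 2)))
    * (besselI0 (lam₂ / c * √(c ^ 2 * t ^ 2 - x ^ 2))
      + c * t / √(c ^ 2 * t ^ 2 - x ^ 2) * besselI1 (lam₂ / c * √(c ^ 2 * t ^ 2 - x ^ 2)))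

/-- The integral term `J_k(r, t)`. -/
def integralJ (c lam₂ : ℝ) (k : ℕ) (r t : ℝ) : ℝ :=
  lam₂ * Real.exp (-(lam₂ * t)) / (2 * c)
    * ∫ x in (-(c * t))..(c * t), integrandJ c lam₂ k r t x

/-- The `k`-th term of the first series in `H(r, t)`. -/
def termA (c lam₁ lam₂ r t : ℝ) (k : ℕ) : ℝ :=
  1 / (k.factorial : ℝ) ^ 2
    * ((lam₁ * t / 2) ^ (2 * k + 1) * (1 + lam₁ * t / (2 * k + 2))
      + (lam₂ * t / 2) ^ (2 * k + 1) * (1 + lam₂ * t / (2 * k + 2)))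
    * hyp k ((1 - r / (c * t)) ^ 2)

/-- The `k`-th term of the second series in `H(r, t)`. -/
def termB (c lam₁ lam₂ r t : ℝ) (k : ℕ) : ℝ :=
  1 / (k.factorial : ℝ) ^ 2 * (lam₁ * t / 2) ^ (2 * k) * (1 + lam₁ * t / (2 * k + 2))
    * integralJ c lam₂ k r t

/-- The function `H(r, t)`. -/
def H (c lam₁ lam₂ r t : ℝ) : ℝ :=
  1 / 2 * ((1 - Real.exp (-(lam₁ * t))) * Real.exp (-(lam₂ * t))
      + Real.exp (-(lam₁ * t)) * (1 - Real.exp (-(lam₂ * t)))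
      + Real.exp (-((lam₁ + lam₂) * t)))
    - Real.exp (-((lam₁ + lam₂) * t)) * (1 - r / (c * t)) * ∑' k : ℕ, termA c lam₁ lam₂ r t k
    + Real.exp (-(lam₁ * t)) * (lam₁ / (2 * c)) * ∑' k : ℕ, termB c lam₁ lam₂ r t k

end Telegraph

end

namespace Telegraph

/-! ### The hypergeometric polynomials and the integrals of `(1 - x²)ᵏ` -/

/-! The law of a telegraph process at time `t` consists of two atoms of mass `exp (-λt) / 2` at
`±ct` and a density on `[-ct, ct]` that is a power series in `1 - x² / (ct)²` (`telegraphLaw`,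
`IsTelegraphProcess.hasLaw`). Given this law, Fubini writes the distribution function of the
distance as `∫ ν₁ (x - r, x + r) dν₂ x`. Splitting both laws into atoms and density gives the
atom-atom term, two mixed terms that reduce by evenness to integrals of a density over `[0, ct -
r]`, and a double integral of densities. Since `∫₀ʸ (1 - x²/d)ᵏ dx = y F(-k, 1/2; 3/2; y²/d)`,
termwise integration turns the mixed terms into the first series of `H` and the double integral into
the second.

The law is identified through exponential moments. Let `Y` be the displacement at unit speed with
positive initial direction. The fundamental theorem of calculus along paths, together with the
independence of `(-1) ^ (N t - N s)` from the past up to `s` and its mean `exp (-2λ(t - s))`, shows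
that `u = E cosh (θY)` and `w = E [(-1)^N sinh (θY)]` solve `u' = θw`, `w' = θu - 2λw` in integral
form. This linear system is solved explicitly (`eq_of_volterra_system`). On the other side, the
moments of the candidate law come from expanding `cosh √(a² + b²)` and `sinh √(a² + b²) / √(a² +
b²)` in powers of `a²` and `b²` and recognising the even moments of `(1 - y²)ᵏ`
(`integral_exp_mul_profile`). The process is bounded at time `t`, so equality of the moment
generating functions gives equality of the laws. -/

lemma ascPochhammer_half_div (n : ℕ) :
    (ascPochhammer ℝ n).eval (1 / 2 : ℝ) * ((ascPochhammer ℝ n).eval (3 / 2 : ℝ))⁻¹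
      = 1 / (2 * n + 1) := by
  have hpos : ∀ n : ℕ, 0 < (ascPochhammer ℝ n).eval (3 / 2 : ℝ) := fun n =>
    ascPochhammer_pos n _ (by norm_num)
  induction n with
  | zero => simp
  | succ n ih =>
    have h := hpos n
    have h2 : (0 : ℝ) < 3 / 2 + n := by positivity
    have h3 : (0 : ℝ) < 2 * n + 1 := by positivity
    rw [ascPochhammer_succ_eval, ascPochhammer_succ_eval]
    rw [← div_eq_mul_inv, div_eq_div_iff h.ne' h3.ne'] at ih
    rw [← div_eq_mul_inv, div_eq_div_iff (by positivity) (by positivity)]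
    push_cast
    linear_combination (n + 3 / 2 : ℝ) * ih

/-- Here `(-k)ₙ / n! = (-1)ⁿ C(k, n)` and `(1/2)ₙ / (3/2)ₙ = 1 / (2n + 1)`; the series stops because
`C(k, n) = 0` for `n > k`. -/
lemma hyp_eq_sum (k : ℕ) (z : ℝ) :
    hyp k z = ∑ n ∈ Finset.range (k + 1), (-1) ^ n * (k.choose n : ℝ) / (2 * n + 1) * z ^ n := by
  rw [hyp, ordinaryHypergeometric_eq_tsum]
  have key : ∀ n : ℕ, ((n.factorial : ℝ)⁻¹ * (ascPochhammer ℝ n).eval (-(k : ℝ))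
      * (ascPochhammer ℝ n).eval (1 / 2 : ℝ) * ((ascPochhammer ℝ n).eval (3 / 2 : ℝ))⁻¹) • z ^ n
      = (-1) ^ n * (k.choose n : ℝ) / (2 * n + 1) * z ^ n := by
    intro n
    have h : (n.factorial : ℝ)⁻¹ * (ascPochhammer ℝ n).eval (-(k : ℝ))
        = (-1) ^ n * (k.choose n : ℝ) := by
      rw [ascPochhammer_eval_neg_eq_descPochhammer, descPochhammer_eval_eq_descFactorial,
        Nat.descFactorial_eq_factorial_mul_choose]
      push_cast
      have : (n.factorial : ℝ) ≠ 0 := by positivity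
      field_simp
    rw [smul_eq_mul, h, mul_assoc ((-1) ^ n * (k.choose n : ℝ)), ascPochhammer_half_div]
    ring
  simp_rw [key]
  refine tsum_eq_sum fun n hn => ?_
  rw [Finset.mem_range, not_lt] at hn
  rw [Nat.choose_eq_zero_of_lt (by omega)]
  simp

/-- Binomial expansion of the integrand, integrated term by term, reproduces the coefficients of
`hyp`. This is the only source of hypergeometric polynomials in the result. -/
lemma mul_hyp_eq_integral (k : ℕ) (d y : ℝ) :
    y * hyp k (y ^ 2 / d) = ∫ x in (0 : ℝ)..y, (1 - x ^ 2 / d) ^ k := by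
  have h : ∀ x : ℝ, (1 - x ^ 2 / d) ^ k
      = ∑ n ∈ Finset.range (k + 1), ((-1) ^ n * (k.choose n : ℝ) / d ^ n) * x ^ (2 * n) := by
    intro x
    rw [sub_eq_add_neg, add_comm, add_pow]
    refine Finset.sum_congr rfl fun n _ => ?_
    rw [neg_pow, one_pow, div_pow, ← pow_mul]
    ring
  simp_rw [h]
  rw [intervalIntegral.integral_finsetSum
    (fun n _ => Continuous.intervalIntegrable (by fun_prop) _ _), hyp_eq_sum, Finset.mul_sum]
  refine Finset.sum_congr rfl fun n _ => ?_
  rw [intervalIntegral.integral_const_mul, integral_pow, div_pow, ← pow_mul]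
  push_cast
  rw [zero_pow (by omega), pow_succ]
  ring

/-- The even moments of the weight `(1 - y²)ᵏ` on `[-1, 1]`. -/
lemma integral_pow_mul_one_sub_sq_pow (n k : ℕ) :
    ∫ y in (-1 : ℝ)..1, y ^ (2 * n) * (1 - y ^ 2) ^ k
      = 2 ^ (2 * k + 1) * (k.factorial : ℝ) ^ 2 * (2 * n).factorial * ((n + k).choose k)
        / (2 * n + 2 * k + 1).factorial := by
  induction k with
  | zero =>
    simp only [pow_zero, mul_one, integral_pow]
    rw [one_pow, Odd.neg_one_pow ⟨n, rfl⟩, Nat.factorial_succ]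
    have : ((2 * n).factorial : ℝ) ≠ 0 := by positivity
    have : (2 * n + 1 : ℝ) ≠ 0 := by positivity
    push_cast
    field_simp
    norm_num
  | succ k ih =>
    -- The integrand is the derivative of `y ^ (2n+1) (1 - y²) ^ (k+1)`, which vanishes at `±1`.
    -- This yields the recursion `(2n + 2k + 3) I (k+1) = 2 (k+1) I k`.
    have hA : ∫ y in (-1 : ℝ)..1, ((2 * n + 1) * (y ^ (2 * n) * (1 - y ^ 2) ^ (k + 1))
        - 2 * (k + 1) * (y ^ (2 * n) * (1 - y ^ 2) ^ k - y ^ (2 * n) * (1 - y ^ 2) ^ (k + 1)))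
        = 0 := by
      have hd : ∀ y ∈ Set.uIcc (-1 : ℝ) 1,
          HasDerivAt (fun y : ℝ => y ^ (2 * n + 1) * (1 - y ^ 2) ^ (k + 1))
          ((2 * n + 1) * (y ^ (2 * n) * (1 - y ^ 2) ^ (k + 1))
            - 2 * (k + 1) * (y ^ (2 * n) * (1 - y ^ 2) ^ k
              - y ^ (2 * n) * (1 - y ^ 2) ^ (k + 1))) y := by
        intro y _
        have h1 : HasDerivAt (fun y : ℝ => 1 - y ^ 2) (-(2 * y)) y := by
          simpa using (hasDerivAt_pow 2 y).const_sub 1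
        convert! (hasDerivAt_pow (2 * n + 1) y).mul (h1.pow (k + 1)) using 1
        simp only [Nat.add_sub_cancel, Pi.pow_apply]
        push_cast
        ring
      rw [intervalIntegral.integral_eq_sub_of_hasDerivAt hd
        (Continuous.intervalIntegrable (by fun_prop) _ _)]
      simp
    rw [intervalIntegral.integral_sub (Continuous.intervalIntegrable (by fun_prop) _ _)
      (Continuous.intervalIntegrable (by fun_prop) _ _), intervalIntegral.integral_const_mul,
      intervalIntegral.integral_const_mul, intervalIntegral.integral_sub
      (Continuous.intervalIntegrable (by fun_prop) _ _)
      (Continuous.intervalIntegrable (by fun_prop) _ _), ih] at hA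
    have h3 : (2 * n + 2 * k + 3 : ℝ) ≠ 0 := by positivity
    have hB : ∫ y in (-1 : ℝ)..1, y ^ (2 * n) * (1 - y ^ 2) ^ (k + 1)
        = 2 * (k + 1) / (2 * n + 2 * k + 3) * (2 ^ (2 * k + 1) * (k.factorial : ℝ) ^ 2
          * (2 * n).factorial * ((n + k).choose k) / (2 * n + 2 * k + 1).factorial) := by
      rw [div_mul_eq_mul_div, eq_div_iff h3]
      linear_combination hA
    have hC : ((n + (k + 1)).choose (k + 1) : ℝ) * (k + 1) = (n + k + 1) * (n + k).choose k := by
      have := Nat.add_one_mul_choose_eq (n + k) k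
      rw [← add_assoc]
      exact_mod_cast this.symm
    have hC' : ((n + (k + 1)).choose (k + 1) : ℝ) = (n + k + 1) * (n + k).choose k / (k + 1) := by
      rw [eq_div_iff (by positivity), hC]
    rw [hB, hC', show 2 * n + 2 * (k + 1) + 1 = (2 * n + 2 * k + 1) + 1 + 1 by ring,
      Nat.factorial_succ (2 * n + 2 * k + 1 + 1), Nat.factorial_succ (2 * n + 2 * k + 1),
      Nat.factorial_succ k]
    have : ((2 * n + 2 * k + 1).factorial : ℝ) ≠ 0 := by positivity
    push_cast
    have h4 : (2 * n + 2 * k + 1 + 1 + 1 : ℝ) ≠ 0 := by positivity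
    have h5 : (2 * n + 2 * k + 1 + 1 : ℝ) ≠ 0 := by positivity
    field_simp
    ring

/-! ### Double series -/

/-- Nonnegativity makes convergence of the diagonal sums enough for unconditional summability, so
the double series may then be summed by rows. -/
lemma hasSum_prod_of_antidiagonal {f : ℕ × ℕ → ℝ} (hf : ∀ p, 0 ≤ f p) {s : ℝ}
    (h : HasSum (fun m => ∑ p ∈ Finset.HasAntidiagonal.antidiagonal m, f p) s) : HasSum f s := by
  rw [← (Finset.HasAntidiagonal.sigmaAntidiagonalEquivProd (A := ℕ)).hasSum_iff]
  have hin : ∀ m : ℕ, HasSum (fun x : Finset.HasAntidiagonal.antidiagonal m => f x)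
      (∑ p ∈ Finset.HasAntidiagonal.antidiagonal m, f p) := fun m => by
    rw [← Finset.sum_coe_sort]
    exact hasSum_fintype _
  have hs : Summable (f ∘ (Finset.HasAntidiagonal.sigmaAntidiagonalEquivProd (A := ℕ))) :=
    (summable_sigma_of_nonneg
      (f := f ∘ (Finset.HasAntidiagonal.sigmaAntidiagonalEquivProd (A := ℕ))) (fun x => hf _)).2
      ⟨fun m => (hin m).summable, h.summable.congr fun m => ((hin m).tsum_eq).symm⟩
  exact (hs.hasSum.sigma (fun m => hin m)).unique h ▸ hs.hasSum

lemma hasSum_prod_of_hasSum_add_pow {w : ℕ → ℝ} (hw : ∀ m, 0 ≤ w m) {x y s : ℝ} (hx : 0 ≤ x)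
    (hy : 0 ≤ y) (h : HasSum (fun m => w m * (x + y) ^ m) s) :
    HasSum (fun p : ℕ × ℕ => w (p.1 + p.2) * ((p.1 + p.2).choose p.2) * x ^ p.1 * y ^ p.2) s := by
  refine hasSum_prod_of_antidiagonal (fun p => by have := hw (p.1 + p.2); positivity) ?_
  convert h using 2 with m
  rw [(Commute.all x y).add_pow', Finset.mul_sum]
  refine Finset.sum_congr rfl fun p hp => ?_
  rw [Finset.HasAntidiagonal.mem_antidiagonal] at hp
  rw [← hp, nsmul_eq_mul, Nat.choose_symm_add]
  ring

/-! ### Exponential moments of the weights `(1 - y²)ᵏ` and of the power series of the density. -/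

lemma integral_exp_mul_one_sub_sq_pow_eq_cosh (a : ℝ) (k : ℕ) :
    ∫ y in (-1 : ℝ)..1, Real.exp (a * y) * (1 - y ^ 2) ^ k
      = ∫ y in (-1 : ℝ)..1, Real.cosh (a * y) * (1 - y ^ 2) ^ k := by
  have h1 : ∫ y in (-1 : ℝ)..1, Real.exp (-(a * y)) * (1 - y ^ 2) ^ k
      = ∫ y in (-1 : ℝ)..1, Real.exp (a * y) * (1 - y ^ 2) ^ k := by
    have := intervalIntegral.integral_comp_neg (a := -1) (b := 1)
      (fun y : ℝ => Real.exp (a * y) * (1 - y ^ 2) ^ k)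
    simpa using this
  have h2 : ∀ y : ℝ, Real.cosh (a * y) * (1 - y ^ 2) ^ k
      = (1 / 2) * (Real.exp (a * y) * (1 - y ^ 2) ^ k)
        + (1 / 2) * (Real.exp (-(a * y)) * (1 - y ^ 2) ^ k) := by
    intro y
    rw [Real.cosh_eq]
    ring
  simp_rw [h2]
  rw [intervalIntegral.integral_add (Continuous.intervalIntegrable (by fun_prop) _ _)
    (Continuous.intervalIntegrable (by fun_prop) _ _), intervalIntegral.integral_const_mul,
    intervalIntegral.integral_const_mul, h1]
  ring

lemma one_sub_sq_mem {y : ℝ} (hy : y ∈ Set.uIoc (-1 : ℝ) 1) : 0 ≤ 1 - y ^ 2 ∧ 1 - y ^ 2 ≤ 1 := by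
  rw [Set.uIoc_of_le (by norm_num)] at hy
  constructor <;> nlinarith [hy.1, hy.2, sq_nonneg y]

lemma abs_one_sub_sq_pow_le {y : ℝ} (hy : y ∈ Set.uIoc (-1 : ℝ) 1) (k : ℕ) :
    |(1 - y ^ 2) ^ k| ≤ 1 := by
  obtain ⟨h0, h1⟩ := one_sub_sq_mem hy
  rw [abs_of_nonneg (by positivity)]
  exact pow_le_one₀ h0 h1

lemma hasSum_integral_exp_mul_one_sub_sq_pow (a : ℝ) (k : ℕ) :
    HasSum (fun n : ℕ => a ^ (2 * n) / (2 * n).factorial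
        * (2 ^ (2 * k + 1) * (k.factorial : ℝ) ^ 2 * (2 * n).factorial * ((n + k).choose k)
          / (2 * n + 2 * k + 1).factorial))
      (∫ y in (-1 : ℝ)..1, Real.exp (a * y) * (1 - y ^ 2) ^ k) := by
  rw [integral_exp_mul_one_sub_sq_pow_eq_cosh]
  simp_rw [← integral_pow_mul_one_sub_sq_pow, ← intervalIntegral.integral_const_mul]
  refine intervalIntegral.hasSum_integral_of_dominated_convergence
    (fun n _ => |a| ^ (2 * n) / (2 * n).factorial)
    (fun n => (by fun_prop : Continuous _).aestronglyMeasurable) ?_ ?_ ?_ ?_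
  · refine fun n => ae_of_all _ fun y hy => ?_
    have h1 := abs_one_sub_sq_pow_le hy k
    have h2 : |y ^ (2 * n)| ≤ 1 := by
      rw [Set.uIoc_of_le (by norm_num)] at hy
      rw [abs_pow]
      exact pow_le_one₀ (abs_nonneg _) (abs_le.2 ⟨hy.1.le, hy.2⟩)
    rw [Real.norm_eq_abs, abs_mul, abs_mul, abs_div, abs_pow, Nat.abs_cast]
    calc _ ≤ |a| ^ (2 * n) / (2 * n).factorial * (1 * 1) := by gcongr
      _ = _ := by ring
  · exact ae_of_all _ fun _ _ => (Real.hasSum_cosh |a|).summable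
  · exact intervalIntegrable_const
  · refine ae_of_all _ fun y _ => ?_
    convert! (Real.hasSum_cosh (a * y)).mul_right ((1 - y ^ 2) ^ k) using 2 with n
    rw [mul_pow]
    ring

/-- With `γ² = a² + b²`, `sinh γ / γ = ∑ γ^(2m) / (2m+1)!`. After binomial expansion, the terms with
a fixed power `b^(2k)` sum to a multiple of the exponential moment of `(1 - y²)ᵏ`. -/
lemma hasSum_sinh_div (a b : ℝ) (hb : 0 < b) :
    HasSum (fun k : ℕ => b ^ (2 * k) / (2 ^ (2 * k + 1) * (k.factorial : ℝ) ^ 2)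
        * ∫ y in (-1 : ℝ)..1, Real.exp (a * y) * (1 - y ^ 2) ^ k)
      (Real.sinh (√(a ^ 2 + b ^ 2)) / √(a ^ 2 + b ^ 2)) := by
  have hg : 0 < √(a ^ 2 + b ^ 2) := by positivity
  have hw : HasSum (fun m : ℕ => (1 / (2 * m + 1).factorial : ℝ) * (b ^ 2 + a ^ 2) ^ m)
      (Real.sinh (√(a ^ 2 + b ^ 2)) / √(a ^ 2 + b ^ 2)) := by
    convert! (Real.hasSum_sinh (√(a ^ 2 + b ^ 2))).div_const (√(a ^ 2 + b ^ 2)) using 2 with m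
    rw [pow_succ (√_), pow_mul, Real.sq_sqrt (by positivity), add_comm (b ^ 2)]
    field_simp
  refine (hasSum_prod_of_hasSum_add_pow (w := fun m => (1 / (2 * m + 1).factorial : ℝ))
    (fun m => by positivity) (sq_nonneg b) (sq_nonneg a) hw).prod_fiberwise fun k => ?_
  convert! (hasSum_integral_exp_mul_one_sub_sq_pow a k).mul_left
    (b ^ (2 * k) / (2 ^ (2 * k + 1) * (k.factorial : ℝ) ^ 2)) using 2 with n
  have h1 : ((2 * n).factorial : ℝ) ≠ 0 := by positivity
  simp only []
  rw [← pow_mul, ← pow_mul, add_comm k n, Nat.choose_symm_add,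
    show 2 * (n + k) + 1 = 2 * n + 2 * k + 1 by ring]
  field_simp

/-- The same expansion of `cosh γ`. The terms free of `b` form `cosh a`; removing them and shifting
the index of `b²` by one leaves the weights `(1 - y²)ᵏ` again. -/
lemma hasSum_cosh_sub (a b : ℝ) :
    HasSum (fun k : ℕ => b ^ (2 * k + 2) / ((2 * k + 2) * (2 ^ (2 * k + 1) * (k.factorial : ℝ) ^ 2))
        * ∫ y in (-1 : ℝ)..1, Real.exp (a * y) * (1 - y ^ 2) ^ k)
      (Real.cosh (√(a ^ 2 + b ^ 2)) - Real.cosh a) := by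
  have hw : HasSum (fun m : ℕ => (1 / (2 * m).factorial : ℝ) * (b ^ 2 + a ^ 2) ^ m)
      (Real.cosh (√(a ^ 2 + b ^ 2))) := by
    convert! Real.hasSum_cosh (√(a ^ 2 + b ^ 2)) using 2 with m
    rw [pow_mul, Real.sq_sqrt (by positivity), add_comm (b ^ 2)]
    field_simp
  have hp := hasSum_prod_of_hasSum_add_pow (w := fun m => (1 / (2 * m).factorial : ℝ))
    (fun m => by positivity) (sq_nonneg b) (sq_nonneg a) hw
  have hz : HasSum (fun n : ℕ => a ^ (2 * n) / (2 * n).factorial) (Real.cosh a) :=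
    Real.hasSum_cosh a
  have h := hp.prod_fiberwise (g := fun k => if k = 0 then Real.cosh a else
      b ^ (2 * (k - 1) + 2) / ((2 * (k - 1 : ℕ) + 2) * (2 ^ (2 * (k - 1) + 1)
        * ((k - 1).factorial : ℝ) ^ 2))
        * ∫ y in (-1 : ℝ)..1, Real.exp (a * y) * (1 - y ^ 2) ^ (k - 1)) fun k => ?_
  · rw [← hasSum_nat_add_iff' 1] at h
    simpa using h
  · rcases k with - | k
    · simp only [if_true]
      convert! hz using 2 with n
      simp [← pow_mul]
      ring
    · simp only [Nat.add_sub_cancel, Nat.succ_ne_zero, if_false]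
      convert! (hasSum_integral_exp_mul_one_sub_sq_pow a k).mul_left
        (b ^ (2 * k + 2) / ((2 * k + 2) * (2 ^ (2 * k + 1) * (k.factorial : ℝ) ^ 2))) using 2 with n
      have h1 : ((2 * n).factorial : ℝ) ≠ 0 := by positivity
      have h2 : ((2 * n + 2 * k + 1).factorial : ℝ) ≠ 0 := by positivity
      have hC : ((n + (k + 1)).choose (k + 1) : ℝ) = (n + k + 1) * (n + k).choose k / (k + 1) := by
        rw [eq_div_iff (by positivity), ← add_assoc]
        exact_mod_cast (Nat.add_one_mul_choose_eq (n + k) k).symm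
      rw [← pow_mul, ← pow_mul, add_comm (k + 1) n, Nat.choose_symm_add,
        show 2 * (n + (k + 1)) = (2 * n + 2 * k + 1) + 1 by ring, hC, Nat.factorial_succ,
        show 2 * (k + 1) = 2 * k + 2 by ring]
      push_cast
      have h3 : (2 * n + 2 * k + 1 + 1 : ℝ) ≠ 0 := by positivity
      have h4 : (2 * k + 2 : ℝ) ≠ 0 := by positivity
      field_simp
      ring

/-- The coefficients of the power series in `1 - x² / (ct)²` of the telegraph density. -/
noncomputable def profileCoeff (b : ℝ) (k : ℕ) : ℝ :=
  1 / (k.factorial : ℝ) ^ 2 * (b / 2) ^ (2 * k) * (1 + b / (2 * k + 2))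

/-- The power series whose value at `1 - x² / (ct)²` is, up to a constant factor, the density of
the telegraph process at `x`. -/
noncomputable def profile (b u : ℝ) : ℝ := ∑' k, profileCoeff b k * u ^ k

lemma profileCoeff_nonneg {b : ℝ} (hb : 0 ≤ b) (k : ℕ) : 0 ≤ profileCoeff b k := by
  unfold profileCoeff
  positivity

lemma summable_besselI0 (z : ℝ) :
    Summable fun k : ℕ => 1 / (k.factorial : ℝ) ^ 2 * (z / 2) ^ (2 * k) := by
  refine Summable.of_nonneg_of_le (fun k => ?_) (fun k => ?_)
    (Real.summable_pow_div_factorial ((z / 2) ^ 2))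
  · rw [pow_mul]; positivity
  · rw [pow_mul, one_div_mul_eq_div]
    have : (1 : ℝ) ≤ k.factorial := by exact_mod_cast k.factorial_pos
    gcongr
    nlinarith

lemma summable_besselI1 (z : ℝ) :
    Summable fun k : ℕ =>
      1 / ((k.factorial : ℝ) * ((k + 1).factorial : ℝ)) * (z / 2) ^ (2 * k + 1) := by
  refine Summable.of_norm_bounded ((summable_besselI0 z).mul_right |z / 2|) (fun k => ?_)
  rw [Real.norm_eq_abs, abs_mul, pow_succ, abs_mul, ← mul_assoc, pow_mul,
    abs_of_nonneg (by positivity), abs_of_nonneg (by positivity : 0 ≤ ((z / 2) ^ 2) ^ k)]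
  have : (k.factorial : ℝ) ≤ (k + 1).factorial := by
    exact_mod_cast Nat.factorial_le (Nat.le_succ k)
  rw [sq (k.factorial : ℝ)]
  gcongr

lemma summable_profileCoeff {b : ℝ} (hb : 0 ≤ b) : Summable (profileCoeff b) := by
  refine Summable.of_nonneg_of_le (profileCoeff_nonneg hb) (fun k => ?_)
    ((summable_besselI0 b).mul_right (1 + b))
  unfold profileCoeff
  have : b / (2 * k + 2) ≤ b := div_le_self hb (by linarith [(Nat.cast_nonneg k : (0 : ℝ) ≤ k)])
  gcongr

lemma profileCoeff_mul_pow_le {b u : ℝ} (hb : 0 ≤ b) (hu : u ∈ Set.Icc (0 : ℝ) 1) (k : ℕ) :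
    ‖profileCoeff b k * u ^ k‖ ≤ profileCoeff b k := by
  have h0 := profileCoeff_nonneg hb k
  rw [Real.norm_eq_abs, abs_of_nonneg (mul_nonneg h0 (pow_nonneg hu.1 k))]
  exact mul_le_of_le_one_right h0 (pow_le_one₀ hu.1 hu.2)

lemma hasSum_profile {b u : ℝ} (hb : 0 ≤ b) (hu : u ∈ Set.Icc (0 : ℝ) 1) :
    HasSum (fun k => profileCoeff b k * u ^ k) (profile b u) :=
  (Summable.of_norm_bounded (summable_profileCoeff hb) (profileCoeff_mul_pow_le hb hu)).hasSum

lemma profile_nonneg {b u : ℝ} (hb : 0 ≤ b) (hu : 0 ≤ u) : 0 ≤ profile b u :=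
  tsum_nonneg fun k => mul_nonneg (profileCoeff_nonneg hb k) (pow_nonneg hu k)

lemma continuousOn_profile {b : ℝ} (hb : 0 ≤ b) : ContinuousOn (profile b) (Set.Icc 0 1) :=
  continuousOn_tsum (fun k => by fun_prop) (summable_profileCoeff hb)
    fun k _ hu => profileCoeff_mul_pow_le hb hu k

/-- Dividing the odd series `I₁` by `√u` leaves integer powers of `u`, so the apparent singularity
disappears. The case `u = 0` is excluded: there the left side is `1` because `1 / 0 = 0`, while
`profile b 0 = 1 + b / 2`. -/
lemma besselI0_add_besselI1_eq_profile {b u : ℝ} (hb : 0 ≤ b) (hu : 0 < u) (hu1 : u ≤ 1) :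
    besselI0 (b * √u) + 1 / √u * besselI1 (b * √u) = profile b u := by
  have h := ((summable_besselI0 (b * √u)).hasSum.add
    ((summable_besselI1 (b * √u)).hasSum.mul_left (1 / √u)))
  refine (h.unique ?_)
  convert! hasSum_profile hb ⟨hu.le, hu1⟩ using 2 with k
  have hs : 0 < √u := Real.sqrt_pos.2 hu
  have hsq : √u ^ (2 * k) = u ^ k := by rw [pow_mul, Real.sq_sqrt hu.le]
  simp only [profileCoeff, pow_succ, mul_div_right_comm b, mul_pow, hsq, Nat.factorial_succ]
  push_cast
  have : (k.factorial : ℝ) ≠ 0 := by positivity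
  field_simp

/-- The exponential moments of the absolutely continuous part of the telegraph law. -/
lemma integral_exp_mul_profile (a b : ℝ) (hb : 0 < b) :
    b / 2 * ∫ y in (-1 : ℝ)..1, Real.exp (a * y) * profile b (1 - y ^ 2)
      = Real.cosh (√(a ^ 2 + b ^ 2))
        + b * (Real.sinh (√(a ^ 2 + b ^ 2)) / √(a ^ 2 + b ^ 2)) - Real.cosh a := by
  have h1 : HasSum (fun k => ∫ y in (-1 : ℝ)..1,
      profileCoeff b k * (Real.exp (a * y) * (1 - y ^ 2) ^ k))
      (∫ y in (-1 : ℝ)..1, Real.exp (a * y) * profile b (1 - y ^ 2)) := by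
    refine intervalIntegral.hasSum_integral_of_dominated_convergence
      (fun k _ => profileCoeff b k * Real.exp |a|)
      (fun n => (by fun_prop : Continuous _).aestronglyMeasurable) ?_ ?_ ?_ ?_
    · refine fun k => ae_of_all _ fun y hy => ?_
      have h1 := abs_one_sub_sq_pow_le hy k
      have h0 := profileCoeff_nonneg hb.le k
      rw [Real.norm_eq_abs, abs_mul, abs_of_nonneg h0, abs_mul, Real.abs_exp]
      have h2 : Real.exp (a * y) ≤ Real.exp |a| := by
        rw [Set.uIoc_of_le (by norm_num)] at hy
        rw [Real.exp_le_exp]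
        refine (le_abs_self _).trans ?_
        rw [abs_mul]
        exact mul_le_of_le_one_right (abs_nonneg _) (abs_le.2 ⟨hy.1.le, hy.2⟩)
      calc _ ≤ profileCoeff b k * (Real.exp |a| * 1) := by gcongr
        _ = _ := by ring
    · exact ae_of_all _ fun _ _ => (summable_profileCoeff hb.le).mul_right _
    · exact intervalIntegrable_const
    · refine ae_of_all _ fun y hy => ?_
      convert! (hasSum_profile hb.le (one_sub_sq_mem hy)).mul_left (Real.exp (a * y)) using 2
      ring
  simp_rw [intervalIntegral.integral_const_mul] at h1
  -- In the factor `1 + b / (2k+2)` of `profileCoeff`, the `1` contributes the `sinh` series and the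
  -- second summand the `cosh` series.
  have h2 := ((hasSum_sinh_div a b hb).mul_left b).add (hasSum_cosh_sub a b)
  rw [add_sub_right_comm, add_comm]
  refine (h1.mul_left (b / 2)).unique ?_
  convert! h2 using 2 with k
  rw [profileCoeff, div_pow]
  have : (k.factorial : ℝ) ≠ 0 := by positivity
  have h4 : (2 * k + 2 : ℝ) ≠ 0 := by positivity
  field_simp
  ring

/-! ### Paths of the telegraph process -/

/-- All paths of `N` start from `0` and are nondecreasing and right-continuous. -/
structure RegularPaths {Ω : Type*} (N : ℝ≥0 → Ω → ℕ) : Prop where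
  zero : ∀ ω, N 0 ω = 0
  monotone : ∀ ω, Monotone fun t => N t ω
  rightContinuous : ∀ ω t, ContinuousWithinAt (fun s => N s ω) (Set.Ici t) t

/-- The sign `(-1) ^ N s` of the velocity. -/
noncomputable def parity {Ω : Type*} (N : ℝ≥0 → Ω → ℕ) (s : ℝ) (ω : Ω) : ℝ :=
  (-1) ^ N s.toNNReal ω

/-- The position at time `t` of the particle of unit speed whose initial direction is positive. -/
noncomputable def displacement {Ω : Type*} (N : ℝ≥0 → Ω → ℕ) (t : ℝ) (ω : Ω) : ℝ :=
  ∫ s in (0 : ℝ)..t, parity N s ω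

section Paths

variable {Ω : Type*} {N : ℝ≥0 → Ω → ℕ}

lemma abs_parity (s : ℝ) (ω : Ω) : |parity N s ω| = 1 := by simp [parity]

lemma RegularPaths.parity_mul_parity (hN : RegularPaths N) {s t : ℝ} (hst : s ≤ t) (ω : Ω) :
    parity N t ω * parity N s ω = (-1) ^ (N t.toNNReal ω - N s.toNNReal ω) := by
  obtain ⟨k, hk⟩ := Nat.exists_eq_add_of_le (hN.monotone ω (Real.toNNReal_le_toNNReal hst))
  simp only at hk
  rw [hk, Nat.add_sub_cancel_left, parity, parity, hk, pow_add, mul_right_comm, ← pow_add,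
    Even.neg_one_pow ⟨_, rfl⟩, one_mul]

/-- An integer-valued right-continuous path is constant just after `s`, and it is nondecreasing;
hence `N s ≤ k` exactly when `N q ≤ k` for some rational `q > s`. This makes the process jointly
measurable. -/
lemma RegularPaths.measurable_uncurry {m : MeasurableSpace Ω} (hN : RegularPaths N)
    (hm : ∀ t, Measurable (N t)) : Measurable fun p : ℝ × Ω => N p.1.toNNReal p.2 := by
  refine measurable_of_Iic fun k => ?_
  have h : (fun p : ℝ × Ω => N p.1.toNNReal p.2) ⁻¹' Set.Iic k
      = ⋃ q : ℚ, {p : ℝ × Ω | p.1 < q} ∩ {p | N (q : ℝ).toNNReal p.2 ≤ k} := by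
    ext ⟨s, ω⟩
    simp only [Set.mem_preimage, Set.mem_Iic, Set.mem_iUnion, Set.mem_inter_iff, Set.mem_ofPred_eq]
    constructor
    · intro h
      have hc := hN.rightContinuous ω s.toNNReal
      have hev : ∀ᶠ u in nhdsWithin s.toNNReal (Set.Ioi s.toNNReal), N u ω = N s.toNNReal ω := by
        have := (hc.mono Set.Ioi_subset_Ici_self).tendsto
        rw [nhds_discrete, Filter.tendsto_pure] at this
        exact this
      obtain ⟨u, hu, hu'⟩ := (hev.and self_mem_nhdsWithin).exists
      obtain ⟨q, hq, hq'⟩ := exists_rat_btwn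
        ((Real.le_coe_toNNReal s).trans_lt (NNReal.coe_lt_coe.2 hu'))
      refine ⟨q, hq, le_trans (hN.monotone ω (Real.toNNReal_le_iff_le_coe.2 hq'.le)) ?_⟩
      simpa [hu] using h
    · rintro ⟨q, hq, hk⟩
      exact (hN.monotone ω (Real.toNNReal_le_toNNReal hq.le)).trans hk
  rw [h]
  refine MeasurableSet.iUnion fun q => (measurableSet_lt measurable_fst measurable_const).inter ?_
  exact measurableSet_le ((hm _).comp measurable_snd) measurable_const

lemma RegularPaths.measurable_parity {m : MeasurableSpace Ω} (hN : RegularPaths N)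
    (hm : ∀ t, Measurable (N t)) : Measurable fun p : ℝ × Ω => parity N p.1 p.2 :=
  (measurable_of_countable fun k : ℕ => (-1 : ℝ) ^ k).comp (hN.measurable_uncurry hm)

lemma RegularPaths.measurable_displacement {m : MeasurableSpace Ω} (hN : RegularPaths N)
    (hm : ∀ t, Measurable (N t)) (t : ℝ) : Measurable (displacement N t) := by
  have h := (hN.measurable_parity hm).stronglyMeasurable
  unfold displacement
  simp_rw [intervalIntegral]
  exact (h.integral_prod_left'.sub h.integral_prod_left').measurable

lemma RegularPaths.measurable_parity_path (hN : RegularPaths N) (ω : Ω) :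
    Measurable fun s => parity N s ω := by
  -- A single path involves no σ-algebra on `Ω`; with the discrete one, joint measurability applies
  -- to any `N` with regular paths.
  let _ : MeasurableSpace Ω := ⊤
  exact (hN.measurable_parity fun _ _ _ => trivial).comp measurable_prodMk_right

lemma RegularPaths.intervalIntegrable_parity (hN : RegularPaths N) (ω : Ω) (a b : ℝ) :
    IntervalIntegrable (fun s => parity N s ω) volume a b := by
  refine (intervalIntegrable_const (c := (1 : ℝ))).mono_fun
    (hN.measurable_parity_path ω).aestronglyMeasurable (ae_of_all _ fun s => ?_)
  simp [abs_parity]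

lemma RegularPaths.continuousWithinAt_parity (hN : RegularPaths N) (ω : Ω) (s : ℝ) :
    ContinuousWithinAt (fun s => parity N s ω) (Set.Ioi s) s := by
  have h1 : ContinuousWithinAt (fun s : ℝ => N s.toNNReal ω) (Set.Ioi s) s :=
    (hN.rightContinuous ω s.toNNReal).comp continuous_real_toNNReal.continuousWithinAt
      fun u hu => Real.toNNReal_le_toNNReal hu.le
  exact (continuous_of_discreteTopology (f := fun k : ℕ => (-1 : ℝ) ^ k)).continuousAt
    |>.comp_continuousWithinAt h1

lemma RegularPaths.continuous_displacement (hN : RegularPaths N) (ω : Ω) :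
    Continuous fun t => displacement N t ω :=
  intervalIntegral.continuous_primitive (fun a b => hN.intervalIntegrable_parity ω a b) 0

/-- Only a right derivative is available, since the velocity jumps at the events of `N`. -/
lemma RegularPaths.hasDerivWithinAt_displacement (hN : RegularPaths N) (ω : Ω) (t : ℝ) :
    HasDerivWithinAt (fun t => displacement N t ω) (parity N t ω) (Set.Ioi t) t :=
  (intervalIntegral.integral_hasDerivWithinAt_right (s := Set.Ici t)
    (hN.intervalIntegrable_parity ω 0 t)
    (hN.measurable_parity_path ω).stronglyMeasurable.stronglyMeasurableAtFilter
    (hN.continuousWithinAt_parity ω t)).mono Set.Ioi_subset_Ici_self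

lemma abs_displacement_le (t : ℝ) (ω : Ω) : |displacement N t ω| ≤ |t| := by
  have := intervalIntegral.norm_integral_le_of_norm_le_const (a := 0) (b := t)
    (f := fun s => parity N s ω) (C := 1) fun s _ => by rw [Real.norm_eq_abs, abs_parity]
  simpa [displacement] using this

lemma exp_abs_mul_displacement_le (θ : ℝ) {s t : ℝ} (hs : s ∈ Set.Ioc 0 t) (ω : Ω) :
    Real.exp |θ * displacement N s ω| ≤ Real.exp (|θ| * t) := by
  rw [Real.exp_le_exp, abs_mul]
  gcongr
  exact (abs_displacement_le s ω).trans ((abs_of_pos hs.1).le.trans hs.2)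

/-- The fundamental theorem of calculus along a path of the telegraph process. -/
lemma RegularPaths.integral_parity_mul_deriv (hN : RegularPaths N) (ω : Ω) {f f' : ℝ → ℝ}
    (hf : ∀ x, HasDerivAt f (f' x) x) (hf' : Continuous f') (t : ℝ) :
    ∫ s in (0 : ℝ)..t, parity N s ω * f' (displacement N s ω)
      = f (displacement N t ω) - f 0 := by
  have hc : Continuous f := continuous_iff_continuousAt.2 fun x => (hf x).continuousAt
  have := intervalIntegral.integral_eq_sub_of_hasDeriv_right (a := 0) (b := t)
    (f := fun s => f (displacement N s ω))
    (f' := fun s => parity N s ω * f' (displacement N s ω))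
    (hc.comp (hN.continuous_displacement ω)).continuousOn
    (fun s _ => by
      rw [mul_comm]
      exact (hf _).comp_hasDerivWithinAt s (hN.hasDerivWithinAt_displacement ω s))
    ((hN.intervalIntegrable_parity ω 0 t).mul_continuousOn
      (hf'.comp (hN.continuous_displacement ω)).continuousOn)
  rw [this]
  simp [displacement]

lemma RegularPaths.stopped (hN : RegularPaths N) (s : ℝ≥0) :
    RegularPaths fun u => N (min u s) where
  zero ω := by simp [hN.zero]
  monotone ω u v huv := hN.monotone ω (min_le_min_right s huv)
  rightContinuous ω t := by
    refine ContinuousWithinAt.comp (f := fun u => min u s) (t := Set.Ici (min t s))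
      (hN.rightContinuous ω (min t s)) (by fun_prop) fun u hu => min_le_min_right s hu

/-- The displacement at time `s` is determined by the path stopped at `s`; this makes it measurable
with respect to the past. -/
lemma displacement_stopped (s : ℝ≥0) (ω : Ω) :
    displacement (fun u => N (min u s)) s ω = displacement N s ω := by
  refine intervalIntegral.integral_congr fun u hu => ?_
  rw [Set.uIcc_of_le s.coe_nonneg] at hu
  simp only [parity]
  rw [min_eq_left (Real.toNNReal_le_iff_le_coe.2 hu.2)]

end Paths

/-! ### Independence of the past from the increments -/

section Independence

variable {Ω : Type*} [MeasurableSpace Ω] {N : ℝ≥0 → Ω → ℕ} {μ : Measure Ω}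

/-- Independence of increments is stated along monotone sequences of times. This puts `0`, finitely
many times up to `s`, `s` itself and `t` on one such sequence, with `s` and `t` consecutive. -/
lemma exists_monotone_seq_covering (I : Finset ℝ≥0) {s t : ℝ≥0} (hst : s ≤ t)
    (hI : ∀ u ∈ I, u ≤ s) : ∃ (τ : ℕ → ℝ≥0) (n : ℕ), Monotone τ ∧ τ 0 = 0 ∧ τ n = s ∧
      τ (n + 1) = t ∧ ∀ u ∈ I, ∃ j ≤ n, τ j = u := by
  set J : Finset ℝ≥0 := insert 0 (insert s I) with hJ
  have hJs : ∀ u ∈ J, u ≤ s := by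
    intro u hu
    simp only [hJ, Finset.mem_insert] at hu
    rcases hu with rfl | rfl | hu
    exacts [zero_le, le_rfl, hI u hu]
  have hcard : 0 < J.card := Finset.card_pos.2 ⟨0, by simp [hJ]⟩
  obtain ⟨n, hn⟩ : ∃ n, J.card = n + 1 := ⟨J.card - 1, by omega⟩
  let e := J.orderEmbOfFin hn
  have hsurj : ∀ u ∈ J, ∃ j : Fin (n + 1), e j = u := fun u hu => by
    have : u ∈ Set.range e := by rw [Finset.range_orderEmbOfFin]; exact hu
    exact this
  let τ : ℕ → ℝ≥0 := fun j => if h : j < n + 1 then e ⟨j, h⟩ else t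
  have hτ : ∀ j : Fin (n + 1), τ j = e j := fun j => by simp only [τ, dif_pos j.2, Fin.eta]
  have hmem : ∀ j, e j ∈ J := fun j => Finset.orderEmbOfFin_mem _ _ _
  refine ⟨τ, n, ?_, ?_, ?_, by simp [τ], ?_⟩
  · intro i j hij
    simp only [τ]
    split_ifs with h1 h2 h2
    · exact e.monotone hij
    · exact (hJs _ (hmem _)).trans hst
    · omega
    · exact le_rfl
  · obtain ⟨j, hj⟩ := hsurj 0 (by simp [hJ])
    have : e 0 ≤ e j := e.monotone (Fin.zero_le _)
    rw [hj] at this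
    simpa [τ] using this
  · obtain ⟨j, hj⟩ := hsurj s (by simp [hJ])
    have h1 : e j ≤ e (Fin.last n) := e.monotone (Fin.le_last _)
    rw [hj] at h1
    have := le_antisymm (hJs _ (hmem (Fin.last n))) h1
    rw [← this, ← hτ]
    simp
  · intro u hu
    obtain ⟨j, hj⟩ := hsurj u (by simp [hJ, hu])
    exact ⟨j, by omega, by rw [hτ, hj]⟩

/-- It suffices to treat finitely many times. On a common grid, the past values are sums of the
first `n` increments, and `N t - N s` is the increment of index `n`. -/
lemma RegularPaths.indepFun_stopped_increment [IsProbabilityMeasure μ] (hN : RegularPaths N)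
    (hm : ∀ t, Measurable (N t)) (hinc : HasIndepIncrements N μ) {s t : ℝ≥0} (hst : s ≤ t) :
    IndepFun (fun ω u => N (min u s) ω) (fun ω => N t ω - N s ω) μ := by
  refine IndepFun.process_indepFun (fun u => hm _) ((hm t).sub (hm s)) fun I => ?_
  obtain ⟨τ, n, hτ, h0, hs, ht, hI⟩ := exists_monotone_seq_covering
    (I.image fun u => min u s) hst (by simp)
  have hidx : ∀ u : I, ∃ j ≤ n, τ j = min (u : ℝ≥0) s := fun u =>
    hI _ (Finset.mem_image_of_mem _ u.2)
  choose j hj hτj using hidx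
  have hind := (hinc.nat hτ).indepFun_finset (Finset.range n) {n} (by simp)
    (fun i => (hm _).sub (hm _))
  have hcomp := hind.comp
    (φ := fun (x : Finset.range n → ℕ) (u : I) =>
      ∑ i : Fin (j u), x ⟨i, Finset.mem_range.2 (i.2.trans_le (hj u))⟩)
    (ψ := fun x : ({n} : Finset ℕ) → ℕ => x ⟨n, Finset.mem_singleton_self n⟩)
    (measurable_pi_lambda _ fun u => Finset.measurable_sum _ fun i _ => measurable_pi_apply _)
    (measurable_pi_apply (X := fun _ : ({n} : Finset ℕ) => ℕ) _)
  convert hcomp using 1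
  · ext ω u
    simp only [Function.comp_apply]
    -- The sum telescopes to `N (τ j) - N 0`; monotone paths make the truncated subtractions exact.
    rw [Fin.sum_univ_eq_sum_range (fun i => N (τ (i + 1)) ω - N (τ i) ω),
      Finset.sum_range_tsub (fun a b hab => hN.monotone ω (hτ hab))]
    simp [h0, hN.zero, hτj]
  · ext ω
    simp [hs, ht]

end Independence

/-! ### Integral equations for the exponential moments of the displacement. -/

lemma integral_neg_one_pow_poissonMeasure (a : ℝ≥0) :
    ∫ n, (-1 : ℝ) ^ n ∂poissonMeasure a = Real.exp (-(2 * a)) := by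
  rw [integral_poissonMeasure]
  have h := (NormedSpace.expSeries_div_hasSum_exp (-(a : ℝ))).mul_left (Real.exp (-a))
  rw [← Real.exp_eq_exp_ℝ, ← Real.exp_add] at h
  rw [show -(2 * (a : ℝ)) = -a + -a by ring, ← h.tsum_eq]
  refine tsum_congr fun n => ?_
  rw [neg_pow (a : ℝ), smul_eq_mul]
  ring

section Moments

variable {Ω : Type*} [MeasurableSpace Ω] {N : ℝ≥0 → Ω → ℕ} {μ : Measure Ω}
  [IsProbabilityMeasure μ]

/-- The product of the two parities is `(-1) ^ (N t - N s)`, which is independent of the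
displacement at `s`; its mean is the Poisson generating function at `-1`. -/
lemma RegularPaths.integral_parity_mul_parity_mul {lam : ℝ≥0} (hN : RegularPaths N)
    (hP : IsPoissonProcess lam N μ) {s t : ℝ} (hs : 0 ≤ s) (hst : s ≤ t) {g : ℝ → ℝ}
    (hg : Continuous g) :
    ∫ ω, parity N t ω * parity N s ω * g (displacement N s ω) ∂μ
      = Real.exp (-(2 * lam * (t - s))) * ∫ ω, g (displacement N s ω) ∂μ := by
  lift s to ℝ≥0 using hs
  lift t to ℝ≥0 using s.2.trans hst
  have hst' : s ≤ t := hst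
  let past : Ω → (ℝ≥0 → ℕ) := fun ω u => N (min u s) ω
  have hpast : @Measurable Ω ℝ (MeasurableSpace.comap past inferInstance) _
      (displacement N s) := by
    have h := (hN.stopped s).measurable_displacement
      (m := MeasurableSpace.comap past inferInstance)
      (fun u => (measurable_pi_apply u).comp (comap_measurable past)) s
    have e : displacement (fun u => N (min u s)) s = displacement N s :=
      funext fun ω => displacement_stopped s ω
    rw [← e]
    exact h
  have hind : IndepFun (fun ω => (-1 : ℝ) ^ (N t ω - N s ω)) (fun ω => g (displacement N s ω)) μ := by
    have h := (hN.indepFun_stopped_increment hP.measurable hP.indepIncrements hst').symm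
    rw [IndepFun_iff_Indep] at h ⊢
    refine indep_of_indep_of_le_left (indep_of_indep_of_le_right h ?_) ?_
    · exact (hg.measurable.comp hpast).comap_le
    · exact ((measurable_of_countable fun k : ℕ => (-1 : ℝ) ^ k).comp
        (comap_measurable fun ω => N t ω - N s ω)).comap_le
  have hmN := (hP.measurable t).sub (hP.measurable s)
  have hm1 : Measurable fun ω => (-1 : ℝ) ^ (N t ω - N s ω) :=
    (measurable_of_countable fun k : ℕ => (-1 : ℝ) ^ k).comp hmN
  have hm2 : Measurable fun ω => g (displacement N s ω) :=
    hg.measurable.comp (hN.measurable_displacement hP.measurable s)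
  calc _ = ∫ ω, (-1 : ℝ) ^ (N t ω - N s ω) * g (displacement N s ω) ∂μ := by
        refine integral_congr_ae (ae_of_all _ fun ω => ?_)
        simp only
        rw [hN.parity_mul_parity hst]
        simp
    _ = (∫ ω, (-1 : ℝ) ^ (N t ω - N s ω) ∂μ) * ∫ ω, g (displacement N s ω) ∂μ :=
        hind.integral_fun_mul_eq_mul_integral hm1.aestronglyMeasurable hm2.aestronglyMeasurable
    _ = _ := by
        have hl := (hP.law s t hst').integral_comp (f := fun k : ℕ => (-1 : ℝ) ^ k)
          (measurable_of_countable _).aestronglyMeasurable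
        simp only [Function.comp_def] at hl
        rw [hl, integral_neg_one_pow_poissonMeasure]
        congr 3
        push_cast [NNReal.coe_sub hst']
        ring

/-- Bounded jointly measurable integrands of the path may be integrated in either order. -/
lemma integral_intervalIntegral_swap {f : ℝ → Ω → ℝ}
    (hf : Measurable fun p : ℝ × Ω => f p.1 p.2) {t C : ℝ} (ht : 0 ≤ t)
    (hC : ∀ s ∈ Set.Ioc 0 t, ∀ ω, |f s ω| ≤ C) :
    ∫ ω, (∫ s in (0 : ℝ)..t, f s ω) ∂μ = ∫ s in (0 : ℝ)..t, (∫ ω, f s ω ∂μ) ∧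
    IntervalIntegrable (fun s => ∫ ω, f s ω ∂μ) volume 0 t := by
  have hint : Integrable (fun p : ℝ × Ω => f p.1 p.2)
      ((volume.restrict (Set.Ioc 0 t)).prod μ) := by
    refine (integrable_const C).mono' hf.aestronglyMeasurable ?_
    have h1 : ∀ᵐ s ∂volume.restrict (Set.Ioc 0 t), s ∈ Set.Ioc 0 t :=
      ae_restrict_mem measurableSet_Ioc
    have h2 : ∀ᵐ p ∂(volume.restrict (Set.Ioc 0 t)).prod μ, p.1 ∈ Set.Ioc 0 t :=
      Measure.quasiMeasurePreserving_fst.ae h1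
    filter_upwards [h2] with p hp using hC _ hp _
  constructor
  · simp_rw [intervalIntegral.integral_of_le ht]
    exact (integral_integral_swap (f := f) hint).symm
  · rw [intervalIntegrable_iff_integrableOn_Ioc_of_le ht]
    exact hint.integral_prod_left

lemma abs_cosh_le (x : ℝ) : |Real.cosh x| ≤ Real.exp |x| := by
  rw [abs_of_pos (Real.cosh_pos x), ← Real.cosh_abs, Real.cosh_eq]
  have := Real.exp_le_exp.2 (neg_le_self (abs_nonneg x))
  linarith

lemma abs_sinh_le (x : ℝ) : |Real.sinh x| ≤ Real.exp |x| := by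
  rw [Real.abs_sinh, Real.sinh_eq]
  have := Real.exp_pos (-|x|)
  have := Real.exp_pos |x|
  linarith

lemma RegularPaths.measurable_uncurry_displacement (hN : RegularPaths N)
    (hm : ∀ t, Measurable (N t)) : Measurable fun p : ℝ × Ω => displacement N p.1 p.2 :=
  measurable_uncurry_of_continuous_of_measurable (u := fun t ω => displacement N t ω)
    (fun ω => hN.continuous_displacement ω) (hN.measurable_displacement hm)

/-- Expectation of the fundamental theorem of calculus for `cosh (θ ·)` along a path: the integral
form of `u' = θw`. -/
lemma RegularPaths.integral_cosh_eq (hN : RegularPaths N) (hm : ∀ t, Measurable (N t)) (θ : ℝ)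
    {t : ℝ} (ht : 0 ≤ t) :
    (∫ ω, Real.cosh (θ * displacement N t ω) ∂μ
      = 1 + θ * ∫ s in (0 : ℝ)..t, ∫ ω, parity N s ω * Real.sinh (θ * displacement N s ω) ∂μ) ∧
    IntervalIntegrable (fun s => ∫ ω, parity N s ω * Real.sinh (θ * displacement N s ω) ∂μ)
      volume 0 t := by
  have hY := hN.measurable_uncurry_displacement hm
  have hswap := integral_intervalIntegral_swap (μ := μ)
    (f := fun s ω => parity N s ω * Real.sinh (θ * displacement N s ω))
    ((hN.measurable_parity hm).mul (Real.measurable_sinh.comp (hY.const_mul θ))) ht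
    (C := Real.exp (|θ| * t)) (fun s hs ω => by
      rw [abs_mul, abs_parity, one_mul]
      exact (abs_sinh_le _).trans (exp_abs_mul_displacement_le θ hs ω))
  refine ⟨?_, hswap.2⟩
  rw [← hswap.1, ← integral_const_mul]
  have hpath : ∀ ω, θ * ∫ s in (0 : ℝ)..t, parity N s ω * Real.sinh (θ * displacement N s ω)
      = Real.cosh (θ * displacement N t ω) - 1 := by
    intro ω
    have h := hN.integral_parity_mul_deriv ω (f := fun x => Real.cosh (θ * x))
      (f' := fun x => Real.sinh (θ * x) * θ)
      (fun x => ((hasDerivAt_id x).const_mul θ).cosh.congr_deriv (by simp)) (by fun_prop) t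
    rw [mul_zero, Real.cosh_zero] at h
    rw [← h, ← intervalIntegral.integral_const_mul]
    congr 1
    ext s
    ring
  simp_rw [hpath]
  rw [integral_sub _ (integrable_const _)]
  · simp
  · refine (integrable_const (Real.exp (|θ| * t))).mono'
      (Real.measurable_cosh.comp ((hN.measurable_displacement hm t).const_mul θ)).aestronglyMeasurable
      (ae_of_all _ fun ω => (abs_cosh_le _).trans ?_)
    rw [Real.exp_le_exp, abs_mul]
    gcongr
    exact (abs_displacement_le t ω).trans (abs_of_nonneg ht).le

/-- The same for `sinh (θ ·)`, multiplied by the parity at the final time `t`; the two parities then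
average to the kernel `exp (-2λ(t - s))`. This is the integral form of `w' = θu - 2λw`. -/
lemma RegularPaths.integral_parity_mul_sinh_eq {lam : ℝ≥0} (hN : RegularPaths N)
    (hP : IsPoissonProcess lam N μ) (θ : ℝ) {t : ℝ} (ht : 0 ≤ t) :
    ∫ ω, parity N t ω * Real.sinh (θ * displacement N t ω) ∂μ
      = θ * ∫ s in (0 : ℝ)..t, Real.exp (-(2 * lam * (t - s)))
          * ∫ ω, Real.cosh (θ * displacement N s ω) ∂μ := by
  have hm := hP.measurable
  have hY := hN.measurable_uncurry_displacement hm
  have hpt : Measurable (parity N t) := (hN.measurable_parity hm).comp measurable_prodMk_left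
  have hswap := integral_intervalIntegral_swap (μ := μ)
    (f := fun s ω => parity N t ω * parity N s ω * Real.cosh (θ * displacement N s ω))
    (((hpt.comp measurable_snd).mul (hN.measurable_parity hm)).mul
      (Real.measurable_cosh.comp (hY.const_mul θ))) ht
    (C := Real.exp (|θ| * t)) (fun s hs ω => by
      rw [abs_mul, abs_mul, abs_parity, abs_parity, one_mul, one_mul]
      exact (abs_cosh_le _).trans (exp_abs_mul_displacement_le θ hs ω))
  have hr : ∫ s in (0 : ℝ)..t, Real.exp (-(2 * lam * (t - s)))
      * ∫ ω, Real.cosh (θ * displacement N s ω) ∂μ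
      = ∫ s in (0 : ℝ)..t, ∫ ω, parity N t ω * parity N s ω
        * Real.cosh (θ * displacement N s ω) ∂μ := by
    refine intervalIntegral.integral_congr fun s hs => ?_
    rw [Set.uIcc_of_le ht] at hs
    exact (hN.integral_parity_mul_parity_mul hP hs.1 hs.2
      (g := fun x => Real.cosh (θ * x)) (by fun_prop)).symm
  rw [hr, ← hswap.1, ← integral_const_mul]
  refine integral_congr_ae (ae_of_all _ fun ω => ?_)
  have h := hN.integral_parity_mul_deriv ω (f := fun x => Real.sinh (θ * x))
    (f' := fun x => Real.cosh (θ * x) * θ)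
    (fun x => ((hasDerivAt_id x).const_mul θ).sinh.congr_deriv (by simp)) (by fun_prop) t
  rw [mul_zero, Real.sinh_zero, sub_zero] at h
  simp only
  rw [← h, ← intervalIntegral.integral_const_mul, ← intervalIntegral.integral_const_mul]
  congr 1
  ext s
  ring

end Moments

/-- The Volterra system satisfied by the exponential moments of a telegraph process determines
them. -/
lemma eq_of_volterra_system {u w : ℝ → ℝ} {θ l : ℝ} (hl : 0 < l)
    (hw : ∀ t, 0 ≤ t → IntervalIntegrable w volume 0 t)
    (hu' : ∀ t, 0 ≤ t → u t = 1 + θ * ∫ s in (0 : ℝ)..t, w s)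
    (hw' : ∀ t, 0 ≤ t → w t = θ * ∫ s in (0 : ℝ)..t, Real.exp (-(2 * l * (t - s))) * u s)
    {t : ℝ} (ht : 0 ≤ t) :
    u t = Real.exp (-(l * t)) * (Real.cosh (√(θ ^ 2 + l ^ 2) * t)
      + l * (Real.sinh (√(θ ^ 2 + l ^ 2) * t) / √(θ ^ 2 + l ^ 2))) := by
  set γ := √(θ ^ 2 + l ^ 2) with hγ
  have hγ0 : 0 < γ := by positivity
  have hγ2 : γ ^ 2 = θ ^ 2 + l ^ 2 := Real.sq_sqrt (by positivity)
  have hprim : ∀ f : ℝ → ℝ, (IntervalIntegrable f volume 0 t) →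
      ContinuousOn (fun x => ∫ s in (0 : ℝ)..x, f s) (Set.Icc 0 t) := by
    intro f hf
    have := intervalIntegral.continuousOn_primitive_interval (a := 0) (b := t) (μ := volume)
      (f := f) (by
        rw [Set.uIcc_of_le ht]
        exact (intervalIntegrable_iff_integrableOn_Icc_of_le ht).1 hf)
    rwa [Set.uIcc_of_le ht] at this
  -- Only integrability of `w` is assumed. Regularity is bootstrapped: `u` is continuous as a
  -- primitive, then so is `w`, and then both have right derivatives.
  have huc : ContinuousOn u (Set.Icc 0 t) :=
    (continuousOn_const.add (continuousOn_const.mul (hprim w (hw t ht)))).congr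
      fun x hx => hu' x hx.1
  have hw'' : ∀ x, 0 ≤ x → w x
      = θ * Real.exp (-(2 * l * x)) * ∫ s in (0 : ℝ)..x, Real.exp (2 * l * s) * u s := by
    intro x hx
    rw [hw' x hx, mul_assoc, ← intervalIntegral.integral_const_mul (Real.exp _)]
    congr 2
    ext s
    rw [← mul_assoc, ← Real.exp_add]
    ring_nf
  have heu : ContinuousOn (fun s => Real.exp (2 * l * s) * u s) (Set.Icc 0 t) :=
    (by fun_prop : Continuous fun s => Real.exp (2 * l * s)).continuousOn.mul huc
  have hwc : ContinuousOn w (Set.Icc 0 t) :=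
    ((by fun_prop : Continuous fun x => θ * Real.exp (-(2 * l * x))).continuousOn.mul
      (hprim _ (heu.intervalIntegrable_of_Icc ht))).congr fun x hx => hw'' x hx.1
  have hderiv : ∀ f : ℝ → ℝ, ContinuousOn f (Set.Icc 0 t) → ∀ x ∈ Set.Ico 0 t,
      HasDerivWithinAt (fun x => ∫ s in (0 : ℝ)..x, f s) (f x) (Set.Ici x) x := by
    intro f hf x hx
    have hsub : Set.Icc 0 t ∈ nhdsWithin x (Set.Ioi x) :=
      Filter.mem_of_superset (Ioo_mem_nhdsGT hx.2)
        fun y hy => ⟨hx.1.trans hy.1.le, hy.2.le⟩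
    refine intervalIntegral.integral_hasDerivWithinAt_right (t := Set.Ioi x)
      ((hf.mono (Set.Icc_subset_Icc_right hx.2.le)).intervalIntegrable_of_Icc hx.1)
      ⟨Set.Icc 0 t, hsub, hf.aestronglyMeasurable measurableSet_Icc⟩ ?_
    exact (hf x ⟨hx.1, hx.2.le⟩).mono_of_mem_nhdsWithin hsub
  have hdu : ∀ x ∈ Set.Ico 0 t, HasDerivWithinAt u (θ * w x) (Set.Ici x) x := by
    intro x hx
    exact (((hderiv w hwc x hx).const_mul θ).const_add 1).congr
      (fun y hy => hu' y (hx.1.trans hy)) (hu' x hx.1)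
  have hdw : ∀ x ∈ Set.Ico 0 t, HasDerivWithinAt w (θ * u x - 2 * l * w x) (Set.Ici x) x := by
    intro x hx
    have h1 : HasDerivAt (fun x => θ * Real.exp (-(2 * l * x)))
        (θ * (Real.exp (-(2 * l * x)) * -(2 * l))) x := by
      have h := ((hasDerivAt_id x).const_mul (2 * l)).neg.exp.const_mul θ
      simpa using h
    refine ((h1.hasDerivWithinAt.mul (hderiv _ heu x hx)).congr
      (fun y hy => hw'' y (hx.1.trans hy)) (hw'' x hx.1)).congr_deriv ?_
    rw [hw'' x hx.1]
    have : Real.exp (-(2 * l * x)) * Real.exp (2 * l * x) = 1 := by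
      rw [← Real.exp_add]; simp
    linear_combination (θ * u x) * this
  have he : ∀ x, HasDerivWithinAt (fun x => Real.exp (l * x)) (l * Real.exp (l * x))
      (Set.Ici x) x := fun x => by
    have h := ((hasDerivAt_id x).const_mul l).exp
    simpa [mul_comm] using h.hasDerivWithinAt
  have hcosh : ∀ x, HasDerivWithinAt (fun x => Real.cosh (γ * x)) (γ * Real.sinh (γ * x))
      (Set.Ici x) x := fun x => by
    have h := ((hasDerivAt_id x).const_mul γ).cosh
    simpa [mul_comm] using h.hasDerivWithinAt
  have hsinh : ∀ x, HasDerivWithinAt (fun x => Real.sinh (γ * x)) (γ * Real.cosh (γ * x))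
      (Set.Ici x) x := fun x => by
    have h := ((hasDerivAt_id x).const_mul γ).sinh
    simpa [mul_comm] using h.hasDerivWithinAt
  -- With `M = !![l, θ; θ, -l]`, so that `M² = γ²`, the system says that `exp (lx) (u, w)` solves
  -- `z' = Mz`. The two conserved quantities are `γ` times the components of `exp (-Mx) z`, where
  -- `exp (-Mx) = cosh (γx) - M sinh (γx) / γ`.
  have hP := constant_of_has_deriv_right_zero (a := 0) (b := t)
    (f := fun x => Real.exp (l * x) * (γ * Real.cosh (γ * x) * u x
      - Real.sinh (γ * x) * (l * u x + θ * w x)))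
    (by fun_prop) (fun x hx => by
      have h := (he x).mul ((((hcosh x).const_mul γ).mul (hdu x hx)).sub
        ((hsinh x).mul (((hdu x hx).const_mul l).add ((hdw x hx).const_mul θ))))
      refine h.congr_deriv ?_
      simp only [Pi.add_apply, Pi.sub_apply, Pi.mul_apply]
      linear_combination (Real.exp (l * x) * Real.sinh (γ * x) * u x) * hγ2) t ⟨ht, le_rfl⟩
  have hQ := constant_of_has_deriv_right_zero (a := 0) (b := t)
    (f := fun x => Real.exp (l * x) * (γ * Real.cosh (γ * x) * w x
      - Real.sinh (γ * x) * (θ * u x - l * w x)))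
    (by fun_prop) (fun x hx => by
      have h := (he x).mul ((((hcosh x).const_mul γ).mul (hdw x hx)).sub
        ((hsinh x).mul (((hdu x hx).const_mul θ).sub ((hdw x hx).const_mul l))))
      refine h.congr_deriv ?_
      simp only [Pi.sub_apply, Pi.mul_apply]
      linear_combination (Real.exp (l * x) * Real.sinh (γ * x) * w x) * hγ2) t ⟨ht, le_rfl⟩
  have hu0 : u 0 = 1 := by simpa using hu' 0 le_rfl
  have hw0 : w 0 = 0 := by simpa using hw' 0 le_rfl
  simp only [mul_zero, Real.exp_zero, Real.cosh_zero, Real.sinh_zero, hu0, hw0] at hP hQ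
  have hE : Real.exp (-(l * t)) * Real.exp (l * t) = 1 := by rw [← Real.exp_add]; simp
  have hcs := Real.cosh_sq_sub_sinh_sq (γ * t)
  have hmain : γ * (Real.exp (l * t) * u t)
      = γ * Real.cosh (γ * t) + l * Real.sinh (γ * t) := by
    have h2 : γ * (γ * (Real.exp (l * t) * u t))
        = γ * (γ * Real.cosh (γ * t) + l * Real.sinh (γ * t)) := by
      -- The multipliers of `hP` and `hQ` are the first row of `γ exp (Mt)`, which inverts the
      -- conserved quantities to recover `u`.
      linear_combination (γ * Real.cosh (γ * t) + l * Real.sinh (γ * t)) * hP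
        + θ * Real.sinh (γ * t) * hQ
        - γ ^ 2 * Real.exp (l * t) * u t * hcs
        - Real.exp (l * t) * u t * Real.sinh (γ * t) ^ 2 * hγ2
    exact mul_left_cancel₀ hγ0.ne' h2
  have hfin : Real.exp (l * t) * u t
      = Real.cosh (γ * t) + l * (Real.sinh (γ * t) / γ) := by
    refine mul_left_cancel₀ hγ0.ne' (hmain.trans ?_)
    field_simp
  rw [← hfin, ← mul_assoc, hE, one_mul]

/-! ### The candidate law -/

/-- The density of the absolutely continuous part of the law at time `t`. -/
noncomputable def telegraphDensity (c lam t x : ℝ) : ℝ :=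
  lam * Real.exp (-(lam * t)) / (2 * c) * profile (lam * t) (1 - x ^ 2 / (c ^ 2 * t ^ 2))

/-- The law at time `t` of the telegraph process of speed `c` and rate `lam`. -/
noncomputable def telegraphLaw (c lam t : ℝ) : Measure ℝ :=
  ENNReal.ofReal (Real.exp (-(lam * t)) / 2) • (Measure.dirac (c * t) + Measure.dirac (-(c * t)))
    + (volume.restrict (Set.Icc (-(c * t)) (c * t))).withDensity
      fun x => ENNReal.ofReal (telegraphDensity c lam t x)

section Law

variable {c lam t : ℝ}

lemma one_sub_sq_div_mem (hc : 0 < c) (ht : 0 < t) {x : ℝ}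
    (hx : x ∈ Set.Icc (-(c * t)) (c * t)) :
    1 - x ^ 2 / (c ^ 2 * t ^ 2) ∈ Set.Icc (0 : ℝ) 1 := by
  have h : x ^ 2 ≤ c ^ 2 * t ^ 2 := by
    rw [← mul_pow]
    exact sq_le_sq' hx.1 hx.2
  have h1 : x ^ 2 / (c ^ 2 * t ^ 2) ≤ 1 := div_le_one_of_le₀ h (by positivity)
  have h2 : 0 ≤ x ^ 2 / (c ^ 2 * t ^ 2) := by positivity
  constructor <;> linarith

lemma telegraphDensity_nonneg (hc : 0 < c) (hl : 0 < lam) (ht : 0 < t) {x : ℝ}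
    (hx : x ∈ Set.Icc (-(c * t)) (c * t)) : 0 ≤ telegraphDensity c lam t x := by
  have := profile_nonneg (b := lam * t) (by positivity) (one_sub_sq_div_mem hc ht hx).1
  unfold telegraphDensity
  positivity

lemma telegraphDensity_neg (x : ℝ) :
    telegraphDensity c lam t (-x) = telegraphDensity c lam t x := by
  simp [telegraphDensity]

lemma continuousOn_telegraphDensity (hc : 0 < c) (hl : 0 < lam) (ht : 0 < t) :
    ContinuousOn (telegraphDensity c lam t) (Set.Icc (-(c * t)) (c * t)) := by
  refine continuousOn_const.mul ?_
  exact (continuousOn_profile (b := lam * t) (by positivity)).comp (by fun_prop)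
    fun x hx => one_sub_sq_div_mem hc ht hx

lemma aemeasurable_ofReal_telegraphDensity (hc : 0 < c) (hl : 0 < lam) (ht : 0 < t) :
    AEMeasurable (fun x => ENNReal.ofReal (telegraphDensity c lam t x))
      (volume.restrict (Set.Icc (-(c * t)) (c * t))) :=
  ((continuousOn_telegraphDensity hc hl ht).aemeasurable measurableSet_Icc).ennreal_ofReal

lemma isFiniteMeasure_telegraphLaw (hc : 0 < c) (hl : 0 < lam) (ht : 0 < t) :
    IsFiniteMeasure (telegraphLaw c lam t) := by
  have h : IsFiniteMeasure ((volume.restrict (Set.Icc (-(c * t)) (c * t))).withDensity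
      fun x => ENNReal.ofReal (telegraphDensity c lam t x)) :=
    isFiniteMeasure_withDensity_ofReal
      ((continuousOn_telegraphDensity hc hl ht).integrableOn_Icc).2
  unfold telegraphLaw
  have h2 : IsFiniteMeasure (ENNReal.ofReal (Real.exp (-(lam * t)) / 2) •
      (Measure.dirac (c * t) + Measure.dirac (-(c * t)))) :=
    Measure.smul_finite _ ENNReal.ofReal_ne_top
  infer_instance

lemma integral_telegraphLaw (hc : 0 < c) (hl : 0 < lam) (ht : 0 < t) {f : ℝ → ℝ}
    (hf : Measurable f) {C : ℝ} (hC : ∀ x ∈ Set.Icc (-(c * t)) (c * t), |f x| ≤ C) :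
    ∫ x, f x ∂telegraphLaw c lam t
      = Real.exp (-(lam * t)) / 2 * (f (c * t) + f (-(c * t)))
        + ∫ x in (-(c * t))..(c * t), telegraphDensity c lam t x * f x := by
  have hct : 0 < c * t := by positivity
  have hd : ∀ a, Integrable f (Measure.dirac a) := fun a => integrable_dirac (by simp)
  have hwd : ∀ x ∈ Set.Icc (-(c * t)) (c * t),
      (ENNReal.ofReal (telegraphDensity c lam t x)).toReal = telegraphDensity c lam t x :=
    fun x hx => ENNReal.toReal_ofReal (telegraphDensity_nonneg hc hl ht hx)
  have hmul : IntegrableOn (fun x => telegraphDensity c lam t x * f x)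
      (Set.Icc (-(c * t)) (c * t)) := by
    refine Integrable.mul_bdd (c := C) (continuousOn_telegraphDensity hc hl ht).integrableOn_Icc
      hf.aestronglyMeasurable ?_
    exact (ae_restrict_iff' measurableSet_Icc).2 (ae_of_all _ hC)
  have hi : Integrable f ((volume.restrict (Set.Icc (-(c * t)) (c * t))).withDensity
      fun x => ENNReal.ofReal (telegraphDensity c lam t x)) := by
    rw [integrable_withDensity_iff_integrable_smul₀' (aemeasurable_ofReal_telegraphDensity hc hl ht)
      (ae_of_all _ fun _ => ENNReal.ofReal_lt_top)]
    exact IntegrableOn.congr_fun hmul (fun x hx => by simp only [hwd x hx, smul_eq_mul])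
      measurableSet_Icc
  rw [telegraphLaw, integral_add_measure
    (((hd _).add_measure (hd _)).smul_measure ENNReal.ofReal_ne_top) hi, integral_smul_measure,
    integral_add_measure (hd _) (hd _), integral_dirac, integral_dirac,
    ENNReal.toReal_ofReal (by positivity),
    integral_withDensity_eq_integral_toReal_smul₀ (aemeasurable_ofReal_telegraphDensity hc hl ht)
      (ae_of_all _ fun _ => ENNReal.ofReal_lt_top),
    intervalIntegral.integral_of_le (by linarith), ← integral_Icc_eq_integral_Ioc]
  congr 1
  exact setIntegral_congr_fun measurableSet_Icc fun x hx => by simp only [hwd x hx, smul_eq_mul]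

/-- The substitution `x = cty` reduces the density to `integral_exp_mul_profile` with `a = θct`, `b
= λt`; the term `-cosh a` there is cancelled by the atoms. -/
lemma integral_exp_telegraphLaw (hc : 0 < c) (hl : 0 < lam) (ht : 0 < t) (θ : ℝ) :
    ∫ x, Real.exp (θ * x) ∂telegraphLaw c lam t
      = Real.exp (-(lam * t)) * (Real.cosh (√((θ * c) ^ 2 + lam ^ 2) * t)
      + lam * (Real.sinh (√((θ * c) ^ 2 + lam ^ 2) * t) / √((θ * c) ^ 2 + lam ^ 2))) := by
  have hct : 0 < c * t := by positivity
  rw [integral_telegraphLaw hc hl ht (by fun_prop) (C := Real.exp (|θ| * (c * t)))]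
  · have hsub := intervalIntegral.integral_comp_mul_left (a := -1) (b := 1)
      (fun x => telegraphDensity c lam t x * Real.exp (θ * x)) hct.ne'
    rw [mul_neg, mul_one, smul_eq_mul, eq_inv_mul_iff_mul_eq₀ hct.ne'] at hsub
    have hcongr : ∀ y : ℝ, telegraphDensity c lam t (c * t * y) * Real.exp (θ * (c * t * y))
        = lam * Real.exp (-(lam * t)) / (2 * c) *
          (Real.exp (θ * c * t * y) * profile (lam * t) (1 - y ^ 2)) := by
      intro y
      rw [telegraphDensity, show (c * t * y) ^ 2 / (c ^ 2 * t ^ 2) = y ^ 2 by field_simp,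
        show θ * (c * t * y) = θ * c * t * y by ring]
      ring
    simp_rw [hcongr] at hsub
    rw [intervalIntegral.integral_const_mul] at hsub
    have hmain := integral_exp_mul_profile (θ * c * t) (lam * t) (by positivity)
    have hsq : √((θ * c * t) ^ 2 + (lam * t) ^ 2) = √((θ * c) ^ 2 + lam ^ 2) * t := by
      rw [show (θ * c * t) ^ 2 + (lam * t) ^ 2 = ((θ * c) ^ 2 + lam ^ 2) * t ^ 2 by ring,
        Real.sqrt_mul (by positivity), Real.sqrt_sq ht.le]
    rw [hsq] at hmain
    have hγ : 0 < √((θ * c) ^ 2 + lam ^ 2) := by positivity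
    have hs : lam * t * (Real.sinh (√((θ * c) ^ 2 + lam ^ 2) * t) / (√((θ * c) ^ 2 + lam ^ 2) * t))
        = lam * (Real.sinh (√((θ * c) ^ 2 + lam ^ 2) * t) / √((θ * c) ^ 2 + lam ^ 2)) := by
      field_simp
    rw [hs] at hmain
    have hcosh : (Real.exp (θ * (c * t)) + Real.exp (θ * -(c * t))) / 2
        = Real.cosh (θ * c * t) := by
      rw [Real.cosh_eq]
      ring_nf
    rw [← hsub]
    have hcoef : c * t * (lam * Real.exp (-(lam * t)) / (2 * c))
        = Real.exp (-(lam * t)) * (lam * t / 2) := by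
      field_simp
    rw [← mul_assoc (c * t), hcoef]
    linear_combination Real.exp (-(lam * t)) * hmain + Real.exp (-(lam * t)) * hcosh
  · intro x hx
    rw [Real.abs_exp, Real.exp_le_exp]
    refine (le_abs_self _).trans ?_
    rw [abs_mul]
    gcongr
    exact abs_le.2 hx

end Law

/-! ### The law of a telegraph process -/

section ProcessLaw

variable {Ω : Type*} [MeasurableSpace Ω] {μ : Measure Ω}

/-- Replacing the paths by zero off a measurable set of full measure makes the regularity hold
everywhere and changes neither the increments' laws nor their independence. -/
lemma IsPoissonProcess.exists_regular_version {lam : ℝ≥0} {N : ℝ≥0 → Ω → ℕ}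
    (hP : IsPoissonProcess lam N μ) : ∃ N' : ℝ≥0 → Ω → ℕ, (∀ᵐ ω ∂μ, ∀ t, N t ω = N' t ω) ∧
      IsPoissonProcess lam N' μ ∧ RegularPaths N' := by
  classical
  have hae := hP.zero.and (hP.monotone.and hP.rightContinuous)
  obtain ⟨G, hG, hGm, hGμ⟩ := hae.exists_measurable_mem
  let N' : ℝ≥0 → Ω → ℕ := fun t => G.indicator (N t)
  have heq : ∀ᵐ ω ∂μ, ∀ t, N t ω = N' t ω := by
    filter_upwards [hG] with ω hω t
    simp [N', hω]
  have hmem : ∀ {ω}, ω ∈ G → ∀ t, N' t ω = N t ω := fun hω t => by simp [N', hω]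
  have hnot : ∀ {ω}, ω ∉ G → ∀ t, N' t ω = 0 := fun hω t => by simp [N', hω]
  have hreg : RegularPaths N' := by
    refine ⟨fun ω => ?_, fun ω => ?_, fun ω => ?_⟩ <;> by_cases hω : ω ∈ G
    · rw [hmem hω]; exact (hGμ _ hω).1
    · rw [hnot hω]
    · simp_rw [hmem hω]; exact (hGμ _ hω).2.1
    · simp_rw [hnot hω]; exact monotone_const
    · simp_rw [hmem hω]; exact (hGμ _ hω).2.2
    · simp_rw [hnot hω]; exact fun t => continuousWithinAt_const
  refine ⟨N', heq, ⟨fun t => (hP.measurable t).indicator hGm, ae_of_all _ hreg.zero,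
    ae_of_all _ hreg.monotone, ae_of_all _ hreg.rightContinuous, fun n τ hτ => ?_,
    fun s t hst => ?_⟩, hreg⟩
  · refine (iIndepFun_congr fun i => ?_).1 (hP.indepIncrements n τ hτ)
    filter_upwards [heq] with ω hω
    rw [hω, hω]
  · refine (hP.law s t hst).congr ?_
    filter_upwards [heq] with ω hω
    rw [hω, hω]

variable [IsProbabilityMeasure μ]

lemma RegularPaths.integral_cosh_displacement {lam : ℝ≥0} {N : ℝ≥0 → Ω → ℕ}
    (hN : RegularPaths N) (hP : IsPoissonProcess lam N μ) (hl : 0 < lam) (θ : ℝ) {t : ℝ}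
    (ht : 0 ≤ t) :
    ∫ ω, Real.cosh (θ * displacement N t ω) ∂μ
      = Real.exp (-(lam * t)) * (Real.cosh (√(θ ^ 2 + lam ^ 2) * t)
      + lam * (Real.sinh (√(θ ^ 2 + lam ^ 2) * t) / √(θ ^ 2 + lam ^ 2))) :=
  eq_of_volterra_system (u := fun t => ∫ ω, Real.cosh (θ * displacement N t ω) ∂μ)
    (w := fun t => ∫ ω, parity N t ω * Real.sinh (θ * displacement N t ω) ∂μ)
    (NNReal.coe_pos.2 hl)
    (fun _ ht => (hN.integral_cosh_eq hP.measurable θ ht).2)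
    (fun _ ht => (hN.integral_cosh_eq hP.measurable θ ht).1)
    (fun _ ht => hN.integral_parity_mul_sinh_eq hP θ ht) ht

/-- The exponential moments of a telegraph process. -/
lemma RegularPaths.integral_exp_direction_mul_displacement {lam : ℝ≥0} {N : ℝ≥0 → Ω → ℕ}
    (hN : RegularPaths N) (hP : IsPoissonProcess lam N μ) {D : Ω → ℝ}
    (hD : Measurable D) (hD1 : μ {ω | D ω = 1} = 1 / 2) (hD2 : μ {ω | D ω = -1} = 1 / 2)
    (hind : IndepFun D (fun ω s => N s ω) μ) (θ : ℝ) {t : ℝ} (ht : 0 ≤ t) :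
    (∀ᵐ ω ∂μ, D ω = 1 ∨ D ω = -1) ∧
    ∫ ω, Real.exp (θ * (D ω * displacement N t ω)) ∂μ
      = ∫ ω, Real.cosh (θ * displacement N t ω) ∂μ := by
  have hs1 : MeasurableSet {ω | D ω = 1} := hD (measurableSet_singleton 1)
  have hs2 : MeasurableSet {ω | D ω = -1} := hD (measurableSet_singleton (-1))
  have hdisj : Disjoint {ω | D ω = 1} {ω | D ω = -1} := by
    rw [Set.disjoint_left]
    intro ω h1 h2
    have h1' : D ω = 1 := h1
    have h2' : D ω = -1 := h2
    linarith
  have hae : ∀ᵐ ω ∂μ, D ω = 1 ∨ D ω = -1 := by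
    have hu : μ ({ω | D ω = 1} ∪ {ω | D ω = -1}) = 1 := by
      rw [measure_union hdisj hs2, hD1, hD2, ENNReal.add_halves]
    exact (mem_ae_iff_prob_eq_one (hs1.union hs2)).2 hu
  refine ⟨hae, ?_⟩
  have hED : ∫ ω, D ω ∂μ = 0 := by
    have h : D =ᵐ[μ] fun ω => {ω | D ω = 1}.indicator (fun _ => (1 : ℝ)) ω
        - {ω | D ω = -1}.indicator (fun _ => (1 : ℝ)) ω := by
      filter_upwards [hae] with ω hω
      rcases hω with hω | hω <;> norm_num [hω, Set.indicator]
    rw [integral_congr_ae h, integral_sub ((integrable_const _).indicator hs1)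
      ((integrable_const _).indicator hs2), integral_indicator_const _ hs1,
      integral_indicator_const _ hs2, measureReal_def, measureReal_def, hD1, hD2, sub_self]
  have hY := hN.measurable_displacement hP.measurable t
  have hbd : ∀ ω, Real.exp |θ * displacement N t ω| ≤ Real.exp (|θ| * t) := fun ω => by
    rw [Real.exp_le_exp, abs_mul]
    gcongr
    exact (abs_displacement_le t ω).trans (abs_of_nonneg ht).le
  have hcosh : Integrable (fun ω => Real.cosh (θ * displacement N t ω)) μ :=
    (integrable_const (Real.exp (|θ| * t))).mono'
      (Real.measurable_cosh.comp (hY.const_mul θ)).aestronglyMeasurable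
      (ae_of_all _ fun ω => (abs_cosh_le _).trans (hbd ω))
  have hmsinh : Measurable fun ω => Real.sinh (θ * displacement N t ω) :=
    Real.measurable_sinh.comp (hY.const_mul θ)
  have hsinh : Integrable (fun ω => D ω * Real.sinh (θ * displacement N t ω)) μ := by
    refine (integrable_const (Real.exp (|θ| * t))).mono' (hD.mul hmsinh).aestronglyMeasurable ?_
    filter_upwards [hae] with ω hω
    have : |D ω| = 1 := by rcases hω with hω | hω <;> simp [hω]
    rw [Real.norm_eq_abs, abs_mul, this, one_mul]
    exact (abs_sinh_le _).trans (hbd ω)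
  have hind' : IndepFun D (fun ω => Real.sinh (θ * displacement N t ω)) μ := by
    rw [IndepFun_iff_Indep] at hind ⊢
    refine indep_of_indep_of_le_right hind ?_
    have h : @Measurable Ω ℝ (MeasurableSpace.comap (fun ω s => N s ω) inferInstance) _
        (displacement N t) :=
      hN.measurable_displacement (m := MeasurableSpace.comap (fun ω s => N s ω) inferInstance)
        (fun u => (measurable_pi_apply u).comp (comap_measurable (fun ω s => N s ω))) t
    have h2 : Measurable fun x : ℝ => Real.sinh (θ * x) := by fun_prop
    exact (h2.comp h).comap_le
  -- As `D = ±1`, `exp (θDY) = cosh (θY) + D sinh (θY)`; the second term vanishes in mean because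
  -- `D` is centred and independent of `Y`.
  have hzero : ∫ ω, D ω * Real.sinh (θ * displacement N t ω) ∂μ = 0 := by
    rw [hind'.integral_fun_mul_eq_mul_integral hD.aestronglyMeasurable hmsinh.aestronglyMeasurable,
      hED, zero_mul]
  have hsplit : (fun ω => Real.exp (θ * (D ω * displacement N t ω))) =ᵐ[μ]
      fun ω => Real.cosh (θ * displacement N t ω) + D ω * Real.sinh (θ * displacement N t ω) := by
    filter_upwards [hae] with ω hω
    rcases hω with hω | hω
    · simp only [hω, one_mul]
      rw [Real.cosh_add_sinh]
    · simp only [hω, neg_mul, one_mul, mul_neg]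
      rw [← sub_eq_add_neg, Real.cosh_sub_sinh]
  rw [integral_congr_ae hsplit, integral_add hcosh hsinh, hzero, add_zero]

/-- The law of a telegraph process at a positive time. -/
theorem IsTelegraphProcess.hasLaw {c : ℝ} (hc : 0 < c) {lam : ℝ≥0} (hl : 0 < lam)
    {X : ℝ≥0 → Ω → ℝ} (hX : IsTelegraphProcess c lam X μ) {t : ℝ≥0} (ht : 0 < t) :
    HasLaw (X t) (telegraphLaw c lam t) μ := by
  obtain ⟨D, N, hD, hD1, hD2, hP, hind, hXt⟩ := hX
  obtain ⟨N', heq, hP', hN'⟩ := hP.exists_regular_version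
  have hind' : IndepFun D (fun ω s => N' s ω) μ := by
    refine hind.congr .rfl ?_
    filter_upwards [heq] with ω hω
    exact funext hω
  have hae : X t =ᵐ[μ] fun ω => c * (D ω * displacement N' t ω) := by
    filter_upwards [heq, hXt] with ω hω hω'
    rw [hω' t, displacement, ← mul_assoc, ← intervalIntegral.integral_const_mul]
    simp only [parity, hω]
  have hm : Measurable fun ω => c * (D ω * displacement N' t ω) :=
    (hD.mul (hN'.measurable_displacement hP'.measurable t)).const_mul c
  have ht' : (0 : ℝ) < t := ht
  have hl' : (0 : ℝ) < lam := hl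
  have := isFiniteMeasure_telegraphLaw hc hl' ht'
  refine HasLaw.congr ⟨hm.aemeasurable, ?_⟩ hae
  have hmgf : mgf (fun ω => c * (D ω * displacement N' t ω)) μ
      = mgf id (telegraphLaw c lam t) := by
    ext θ
    simp only [mgf, id]
    rw [integral_exp_telegraphLaw hc hl' ht', ← hN'.integral_cosh_displacement hP' hl _ ht'.le,
      ← (hN'.integral_exp_direction_mul_displacement hP' hD hD1 hD2 hind' _ ht'.le).2]
    simp_rw [mul_assoc]
  have hexp : integrableExpSet (fun ω => c * (D ω * displacement N' t ω)) μ = Set.univ := by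
    refine Set.eq_univ_of_forall fun θ => integrable_exp_mul_of_mem_Icc (a := -(c * t))
      (b := c * t) hm.aemeasurable ?_
    filter_upwards [(hN'.integral_exp_direction_mul_displacement hP' hD hD1 hD2 hind' 0 ht'.le).1]
      with ω hω
    have h1 : |D ω| = 1 := by rcases hω with hω | hω <;> simp [hω]
    refine abs_le.1 ?_
    rw [abs_mul, abs_mul, h1, one_mul, abs_of_pos hc]
    gcongr
    exact (abs_displacement_le _ ω).trans (abs_of_pos ht').le
  -- Boundedness makes the moment generating function finite on all of `ℝ`, so the complex ones
  -- agree on the whole plane, and these determine the measure.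
  have hcm := eqOn_complexMGF_of_mgf hmgf
  rw [hexp, interior_univ] at hcm
  have := Measure.ext_of_complexMGF_eq hm.aemeasurable aemeasurable_id
    (funext fun z => hcm (Set.mem_univ z.re))
  rwa [Measure.map_id] at this

end ProcessLaw

/-! ### Primitives of the density -/

section Primitive

variable {c lam t : ℝ}

/-- Termwise integration of the density; on `[-ct, ct]` the terms are dominated by the summable
coefficients. -/
lemma hasSum_integral_telegraphDensity (hc : 0 < c) (hl : 0 < lam) (ht : 0 < t) {y z : ℝ}
    (hy : y ∈ Set.Icc (-(c * t)) (c * t)) (hz : z ∈ Set.Icc (-(c * t)) (c * t)) :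
    HasSum (fun k => lam * Real.exp (-(lam * t)) / (2 * c) * (profileCoeff (lam * t) k
        * (z * hyp k (z ^ 2 / (c ^ 2 * t ^ 2)) - y * hyp k (y ^ 2 / (c ^ 2 * t ^ 2)))))
      (∫ x in y..z, telegraphDensity c lam t x) := by
  have hlt : 0 ≤ lam * t := by positivity
  have hsub : ∀ x ∈ Set.uIoc y z, x ∈ Set.Icc (-(c * t)) (c * t) := fun x hx =>
    Set.uIcc_subset_Icc hy hz (Set.uIoc_subset_uIcc hx)
  have hI : ∀ k : ℕ, z * hyp k (z ^ 2 / (c ^ 2 * t ^ 2)) - y * hyp k (y ^ 2 / (c ^ 2 * t ^ 2))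
      = ∫ x in y..z, (1 - x ^ 2 / (c ^ 2 * t ^ 2)) ^ k := fun k => by
    rw [mul_hyp_eq_integral, mul_hyp_eq_integral, intervalIntegral.integral_interval_sub_left]
    all_goals exact Continuous.intervalIntegrable (by fun_prop) _ _
  simp_rw [hI, telegraphDensity, ← intervalIntegral.integral_const_mul]
  refine intervalIntegral.hasSum_integral_of_dominated_convergence
    (fun k _ => lam * Real.exp (-(lam * t)) / (2 * c) * profileCoeff (lam * t) k)
    (fun k => (by fun_prop : Continuous _).aestronglyMeasurable) ?_ ?_ ?_ ?_
  · refine fun k => ae_of_all _ fun x hx => ?_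
    rw [norm_mul, Real.norm_of_nonneg (by positivity)]
    gcongr
    exact profileCoeff_mul_pow_le hlt (one_sub_sq_div_mem hc ht (hsub x hx)) k
  · exact ae_of_all _ fun _ _ => (summable_profileCoeff hlt).mul_left _
  · exact intervalIntegrable_const
  · exact ae_of_all _ fun x hx =>
      (hasSum_profile hlt (one_sub_sq_div_mem hc ht (hsub x hx))).mul_left _

lemma intervalIntegrable_telegraphDensity (hc : 0 < c) (hl : 0 < lam) (ht : 0 < t) {y z : ℝ}
    (hy : y ∈ Set.Icc (-(c * t)) (c * t)) (hz : z ∈ Set.Icc (-(c * t)) (c * t)) :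
    IntervalIntegrable (telegraphDensity c lam t) volume y z :=
  ((continuousOn_telegraphDensity hc hl ht).mono (Set.uIcc_subset_Icc hy hz)).intervalIntegrable

lemma integral_telegraphDensity_neg (y z : ℝ) :
    ∫ x in (-z)..(-y), telegraphDensity c lam t x = ∫ x in y..z, telegraphDensity c lam t x := by
  rw [← intervalIntegral.integral_comp_neg]
  simp_rw [telegraphDensity_neg]

/-- `√z * hyp k z` is the integral of `(1 - x²)ᵏ`, a function with values in `[0, 1]`, over `[0,
√z]`. -/
lemma abs_hyp_le_one (k : ℕ) {z : ℝ} (hz : z ∈ Set.Icc (0 : ℝ) 1) : |hyp k z| ≤ 1 := by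
  rcases hz.1.eq_or_lt with h0 | h0
  · rw [← h0, hyp, ordinaryHypergeometric_zero, abs_one]
  · have hs : 0 < √z := Real.sqrt_pos.2 h0
    have h := mul_hyp_eq_integral k 1 (√z)
    rw [div_one, Real.sq_sqrt h0.le] at h
    have hb := intervalIntegral.norm_integral_le_of_norm_le_const (a := 0) (b := √z)
      (f := fun x : ℝ => (1 - x ^ 2 / 1) ^ k) (C := 1) fun x hx => by
        rw [Set.uIoc_of_le hs.le] at hx
        rw [div_one]
        refine abs_one_sub_sq_pow_le ?_ k
        rw [Set.uIoc_of_le (by norm_num)]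
        exact ⟨by linarith [hx.1], hx.2.trans (Real.sqrt_le_one.2 hz.2)⟩
    rw [← h, sub_zero, one_mul, Real.norm_eq_abs, abs_mul] at hb
    exact le_of_mul_le_mul_left (by simpa using hb) (abs_pos.2 hs.ne')

lemma continuous_hyp (k : ℕ) : Continuous (hyp k) := by
  have : hyp k = fun z => ∑ n ∈ Finset.range (k + 1),
      (-1) ^ n * (k.choose n : ℝ) / (2 * n + 1) * z ^ n := funext (hyp_eq_sum k)
  rw [this]
  fun_prop

end Primitive

/-! ### The integration window -/

section Window

lemma integral_mul_indicator_Ioo {a u v : ℝ} (h : max (-a) u ≤ min a v) (f : ℝ → ℝ) :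
    ∫ x in (-a)..a, f x * (Set.Ioo u v).indicator (fun _ => (1 : ℝ)) x
      = ∫ x in (max (-a) u)..(min a v), f x := by
  have ha : -a ≤ a := (le_max_left _ _).trans (h.trans (min_le_left _ _))
  have hi : ∀ x, f x * (Set.Ioo u v).indicator (fun _ => (1 : ℝ)) x
      = (Set.Ioo u v).indicator f x := fun x => by
    by_cases hx : x ∈ Set.Ioo u v <;> simp [hx]
  simp_rw [hi]
  rw [intervalIntegral.integral_of_le ha, intervalIntegral.integral_of_le h,
    setIntegral_indicator measurableSet_Ioo]
  refine setIntegral_congr_set ?_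
  have h1 : (Set.Ioc (-a) a ∩ Set.Ioo u v : Set ℝ) =ᵐ[volume]
      (Set.Ioc (-a) a ∩ Set.Ioc u v : Set ℝ) :=
    Filter.EventuallyEq.inter (Filter.EventuallyEq.refl _ _) Ioo_ae_eq_Ioc
  refine h1.trans (Filter.EventuallyEq.of_eq ?_)
  rw [Set.Ioc_inter_Ioc]

variable {c t r x : ℝ}

lemma alpha_mem (hc : 0 < c) (ht : 0 < t) (hr : 0 < r)
    (hx : x ∈ Set.Icc (-(c * t)) (c * t)) : alpha c t x r ∈ Set.Icc (-(c * t)) (c * t) := by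
  have : 0 < c * t := by positivity
  exact ⟨le_max_left _ _, max_le (by linarith) (by linarith [hx.2])⟩

lemma beta_mem (hc : 0 < c) (ht : 0 < t) (hr : 0 < r)
    (hx : x ∈ Set.Icc (-(c * t)) (c * t)) : beta c t x r ∈ Set.Icc (-(c * t)) (c * t) := by
  have : 0 < c * t := by positivity
  exact ⟨le_min (by linarith) (by linarith [hx.1]), min_le_left _ _⟩

lemma alpha_le_beta (hc : 0 < c) (ht : 0 < t) (hr : 0 < r)
    (hx : x ∈ Set.Icc (-(c * t)) (c * t)) : alpha c t x r ≤ beta c t x r := by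
  have : 0 < c * t := by positivity
  exact max_le (beta_mem hc ht hr hx).1 (le_min (by linarith [hx.2]) (by linarith))

variable {lam : ℝ}

/-- The indicators record, as functions of the centre `x`, which atoms are caught. The excess `1`
beyond `±ct` is arbitrary: it only keeps the points `x = ±ct` inside the open intervals. -/
lemma telegraphLaw_real_Ioo (hc : 0 < c) (hl : 0 < lam) (ht : 0 < t) (hr : 0 < r)
    (hx : x ∈ Set.Icc (-(c * t)) (c * t)) :
    (telegraphLaw c lam t).real (Set.Ioo (x - r) (x + r))
      = Real.exp (-(lam * t)) / 2 * ((Set.Ioo (c * t - r) (c * t + 1)).indicator (fun _ => 1) x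
          + (Set.Ioo (-(c * t) - 1) (-(c * t) + r)).indicator (fun _ => 1) x)
        + ∫ y in (alpha c t x r)..(beta c t x r), telegraphDensity c lam t y := by
  rw [← integral_indicator_one measurableSet_Ioo]
  have h := integral_telegraphLaw hc hl ht (C := 1)
    (f := (Set.Ioo (x - r) (x + r)).indicator fun _ => (1 : ℝ))
    (measurable_const.indicator measurableSet_Ioo) (fun y _ => by
      by_cases hy : y ∈ Set.Ioo (x - r) (x + r) <;> simp [hy])
  rw [integral_mul_indicator_Ioo (alpha_le_beta hc ht hr hx)] at h
  refine h.trans ?_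
  have e1 : (Set.Ioo (x - r) (x + r)).indicator (fun _ => (1 : ℝ)) (c * t)
      = (Set.Ioo (c * t - r) (c * t + 1)).indicator (fun _ => 1) x := by
    have : c * t ∈ Set.Ioo (x - r) (x + r) ↔ x ∈ Set.Ioo (c * t - r) (c * t + 1) := by
      constructor <;> rintro ⟨h1, h2⟩ <;> constructor <;> linarith [hx.1, hx.2]
    simp only [Set.indicator, this]
  have e2 : (Set.Ioo (x - r) (x + r)).indicator (fun _ => (1 : ℝ)) (-(c * t))
      = (Set.Ioo (-(c * t) - 1) (-(c * t) + r)).indicator (fun _ => 1) x := by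
    have : -(c * t) ∈ Set.Ioo (x - r) (x + r) ↔ x ∈ Set.Ioo (-(c * t) - 1) (-(c * t) + r) := by
      constructor <;> rintro ⟨h1, h2⟩ <;> constructor <;> linarith [hx.1, hx.2]
    simp only [Set.indicator, this]
  rw [e1, e2]
  rfl

end Window

/-! ### The distance of two independent telegraph processes -/

section Distance

lemma distanceCDF_eq_integral {Ω : Type*} [MeasurableSpace Ω] {μ : Measure Ω}
    [IsProbabilityMeasure μ] {X₁ X₂ : ℝ≥0 → Ω → ℝ} {ν₁ ν₂ : Measure ℝ} [IsFiniteMeasure ν₁]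
    [IsFiniteMeasure ν₂] {t : ℝ≥0} (h₁ : HasLaw (X₁ t) ν₁ μ) (h₂ : HasLaw (X₂ t) ν₂ μ)
    (hind : IndepFun (X₁ t) (X₂ t) μ) (r : ℝ) :
    Measurable (fun x => ν₁.real (Set.Ioo (x - r) (x + r))) ∧
    distanceCDF μ X₁ X₂ r t = ∫ x, ν₁.real (Set.Ioo (x - r) (x + r)) ∂ν₂ := by
  have hS : MeasurableSet {p : ℝ × ℝ | |p.1 - p.2| < r} :=
    measurableSet_lt (by fun_prop) measurable_const
  have hset : ∀ x : ℝ, (fun y => (y, x)) ⁻¹' {p : ℝ × ℝ | |p.1 - p.2| < r}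
      = Set.Ioo (x - r) (x + r) := fun x => by
    ext y
    simp only [Set.mem_preimage, Set.mem_ofPred_eq, Set.mem_Ioo, abs_lt]
    constructor <;> rintro ⟨h1, h2⟩ <;> constructor <;> linarith
  have hmeas : Measurable fun x => ν₁ (Set.Ioo (x - r) (x + r)) := by
    simp_rw [← hset]
    exact measurable_measure_prodMk_right hS
  refine ⟨hmeas.ennreal_toReal, ?_⟩
  rw [distanceCDF, (hind.hasLaw_prod h₁ h₂).measureReal_eq hS, measureReal_def,
    Measure.prod_apply_symm hS]
  simp_rw [hset, measureReal_def]
  exact (integral_toReal hmeas.aemeasurable (ae_of_all _ fun _ => measure_lt_top _ _)).symm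

variable {c lam lam₁ lam₂ r t : ℝ}

/-- The moment formula at `θ = 0` gives total mass one, of which the atoms take `exp (-λt)`. -/
lemma integral_telegraphDensity_eq (hc : 0 < c) (hl : 0 < lam) (ht : 0 < t) :
    ∫ x in (-(c * t))..(c * t), telegraphDensity c lam t x = 1 - Real.exp (-(lam * t)) := by
  have h := integral_exp_telegraphLaw hc hl ht 0
  simp only [zero_mul, Real.exp_zero] at h
  rw [integral_telegraphLaw hc hl ht measurable_const (C := 1) (by simp)] at h
  have hs : √(0 ^ 2 + lam ^ 2) = lam := by
    rw [zero_pow two_ne_zero, zero_add, Real.sqrt_sq hl.le]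
  have h2 : lam * (Real.sinh (lam * t) / lam) = Real.sinh (lam * t) := by field_simp
  have h3 : Real.exp (-(lam * t)) * Real.exp (lam * t) = 1 := by rw [← Real.exp_add]; simp
  rw [hs, h2, Real.cosh_add_sinh, h3] at h
  simp only [mul_one] at h
  linarith

/-- The mass that the absolutely continuous part gives to `[ct - r, ct]`. -/
lemma integral_telegraphDensity_tail (hc : 0 < c) (hl : 0 < lam) (ht : 0 < t) (hr : 0 < r)
    (hr2 : r ≤ 2 * c * t) :
    ∫ x in (c * t - r)..(c * t), telegraphDensity c lam t x
      = 1 / 2 * (1 - Real.exp (-(lam * t)))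
        - ∫ x in (0 : ℝ)..(c * t - r), telegraphDensity c lam t x := by
  have hct : 0 < c * t := by positivity
  have m0 : (0 : ℝ) ∈ Set.Icc (-(c * t)) (c * t) := ⟨by linarith, hct.le⟩
  have m1 : c * t ∈ Set.Icc (-(c * t)) (c * t) := ⟨by linarith, le_rfl⟩
  have m2 : -(c * t) ∈ Set.Icc (-(c * t)) (c * t) := ⟨le_rfl, by linarith⟩
  have m3 : c * t - r ∈ Set.Icc (-(c * t)) (c * t) := ⟨by linarith, by linarith⟩
  have h := integral_telegraphDensity_eq hc hl ht
  have h1 := intervalIntegral.integral_add_adjacent_intervals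
    (intervalIntegrable_telegraphDensity hc hl ht m2 m0)
    (intervalIntegrable_telegraphDensity hc hl ht m0 m1)
  have h2 := intervalIntegral.integral_add_adjacent_intervals
    (intervalIntegrable_telegraphDensity hc hl ht m0 m3)
    (intervalIntegrable_telegraphDensity hc hl ht m3 m1)
  have h3 := integral_telegraphDensity_neg (c := c) (lam := lam) (t := t) 0 (c * t)
  rw [neg_zero] at h3
  linarith

lemma integral_telegraphDensity_head :
    ∫ x in (-(c * t))..(-(c * t) + r), telegraphDensity c lam t x
      = ∫ x in (c * t - r)..(c * t), telegraphDensity c lam t x := by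
  rw [← integral_telegraphDensity_neg (c * t - r) (c * t)]
  congr 1
  ring

lemma continuousOn_integral_window (hc : 0 < c) (hl : 0 < lam) (ht : 0 < t) (hr : 0 < r) :
    ContinuousOn (fun x => ∫ y in (alpha c t x r)..(beta c t x r), telegraphDensity c lam t y)
      (Set.Icc (-(c * t)) (c * t)) := by
  have hct : 0 < c * t := by positivity
  have m0 : (0 : ℝ) ∈ Set.Icc (-(c * t)) (c * t) := ⟨by linarith, hct.le⟩
  have hprim : ContinuousOn (fun x => ∫ y in (0 : ℝ)..x, telegraphDensity c lam t y)
      (Set.Icc (-(c * t)) (c * t)) := by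
    have h := intervalIntegral.continuousOn_primitive_interval' (a := 0) (b₁ := -(c * t))
      (b₂ := c * t) (intervalIntegrable_telegraphDensity hc hl ht ⟨le_rfl, by linarith⟩
        ⟨by linarith, le_rfl⟩) (by rwa [Set.uIcc_of_le (by linarith)])
    rwa [Set.uIcc_of_le (by linarith)] at h
  have hα : Continuous fun x => alpha c t x r := by unfold alpha; fun_prop
  have hβ : Continuous fun x => beta c t x r := by unfold beta; fun_prop
  refine ((hprim.comp hβ.continuousOn fun x hx => beta_mem hc ht hr hx).sub
    (hprim.comp hα.continuousOn fun x hx => alpha_mem hc ht hr hx)).congr fun x hx => ?_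
  exact (intervalIntegral.integral_interval_sub_left
    (intervalIntegrable_telegraphDensity hc hl ht m0 (beta_mem hc ht hr hx))
    (intervalIntegrable_telegraphDensity hc hl ht m0 (alpha_mem hc ht hr hx))).symm

/-- The distribution function of the distance, before the expansion into series. -/
lemma integral_telegraphLaw_real_Ioo (hc : 0 < c) (hl₁ : 0 < lam₁) (hl₂ : 0 < lam₂) (ht : 0 < t)
    (hr : 0 < r) (hr2 : r ≤ 2 * c * t)
    (hmeas : Measurable fun x => (telegraphLaw c lam₁ t).real (Set.Ioo (x - r) (x + r))) :
    ∫ x, (telegraphLaw c lam₁ t).real (Set.Ioo (x - r) (x + r)) ∂telegraphLaw c lam₂ t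
      = Real.exp (-(lam₂ * t)) * (Real.exp (-(lam₁ * t)) / 2
          + (1 / 2 * (1 - Real.exp (-(lam₁ * t)))
            - ∫ x in (0 : ℝ)..(c * t - r), telegraphDensity c lam₁ t x))
        + Real.exp (-(lam₁ * t)) * (1 / 2 * (1 - Real.exp (-(lam₂ * t)))
            - ∫ x in (0 : ℝ)..(c * t - r), telegraphDensity c lam₂ t x)
        + ∫ x in (-(c * t))..(c * t), telegraphDensity c lam₂ t x
            * ∫ y in (alpha c t x r)..(beta c t x r), telegraphDensity c lam₁ t y := by
  have hct : 0 < c * t := by positivity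
  have hcct : -(c * t) ≤ c * t := by linarith
  have m1 : c * t ∈ Set.Icc (-(c * t)) (c * t) := ⟨hcct, le_rfl⟩
  have m2 : -(c * t) ∈ Set.Icc (-(c * t)) (c * t) := ⟨le_rfl, hcct⟩
  have := isFiniteMeasure_telegraphLaw hc hl₁ ht
  rw [integral_telegraphLaw hc hl₂ ht hmeas (C := (telegraphLaw c lam₁ t).real Set.univ)
    (fun x _ => by
      rw [abs_of_nonneg measureReal_nonneg]
      exact measureReal_mono (Set.subset_univ _))]
  have hint : ∫ x in (-(c * t))..(c * t), telegraphDensity c lam₂ t x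
        * (telegraphLaw c lam₁ t).real (Set.Ioo (x - r) (x + r))
      = ∫ x in (-(c * t))..(c * t), (Real.exp (-(lam₁ * t)) / 2
          * (telegraphDensity c lam₂ t x
            * (Set.Ioo (c * t - r) (c * t + 1)).indicator (fun _ => (1 : ℝ)) x)
          + Real.exp (-(lam₁ * t)) / 2 * (telegraphDensity c lam₂ t x
            * (Set.Ioo (-(c * t) - 1) (-(c * t) + r)).indicator (fun _ => (1 : ℝ)) x)
          + telegraphDensity c lam₂ t x
            * ∫ y in (alpha c t x r)..(beta c t x r), telegraphDensity c lam₁ t y) := by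
    refine intervalIntegral.integral_congr fun x hx => ?_
    rw [Set.uIcc_of_le hcct] at hx
    rw [telegraphLaw_real_Ioo hc hl₁ ht hr hx]
    ring
  have hdens := intervalIntegrable_telegraphDensity hc hl₂ ht m2 m1
  have hind : ∀ u v : ℝ, IntervalIntegrable (fun x => Real.exp (-(lam₁ * t)) / 2
      * (telegraphDensity c lam₂ t x * (Set.Ioo u v).indicator (fun _ => (1 : ℝ)) x))
      volume (-(c * t)) (c * t) := fun u v => by
    refine IntervalIntegrable.const_mul ?_ _
    rw [intervalIntegrable_iff] at hdens ⊢
    refine Integrable.mul_bdd (c := 1) hdens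
      (measurable_const.indicator measurableSet_Ioo).aestronglyMeasurable (ae_of_all _ fun x => ?_)
    by_cases hx : x ∈ Set.Ioo u v <;> simp [hx]
  have hwin : IntervalIntegrable (fun x => telegraphDensity c lam₂ t x
      * ∫ y in (alpha c t x r)..(beta c t x r), telegraphDensity c lam₁ t y)
      volume (-(c * t)) (c * t) :=
    ((continuousOn_telegraphDensity hc hl₂ ht).mul
      (continuousOn_integral_window hc hl₁ ht hr)).intervalIntegrable_of_Icc hcct
  have hM1 : max (-(c * t)) (c * t - r) = c * t - r := max_eq_right (by linarith)
  have hM2 : max (-(c * t)) (-(c * t) - 1) = -(c * t) := max_eq_left (by linarith)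
  have hm1 : min (c * t) (c * t + 1) = c * t := min_eq_left (by linarith)
  have hm2 : min (c * t) (-(c * t) + r) = -(c * t) + r := min_eq_right (by linarith)
  rw [hint, intervalIntegral.integral_add ((hind _ _).add (hind _ _)) hwin,
    intervalIntegral.integral_add (hind _ _) (hind _ _), intervalIntegral.integral_const_mul,
    intervalIntegral.integral_const_mul,
    integral_mul_indicator_Ioo (by rw [hM1, hm1]; linarith),
    integral_mul_indicator_Ioo (by rw [hM2, hm2]; linarith), hM1, hM2, hm1, hm2,
    integral_telegraphDensity_head, integral_telegraphDensity_tail hc hl₂ ht hr hr2,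
    telegraphLaw_real_Ioo hc hl₁ ht hr m1, telegraphLaw_real_Ioo hc hl₁ ht hr m2]
  have hα1 : alpha c t (c * t) r = c * t - r := hM1
  have hβ1 : beta c t (c * t) r = c * t := min_eq_left (by linarith)
  have hα2 : alpha c t (-(c * t)) r = -(c * t) := max_eq_left (by linarith)
  have hβ2 : beta c t (-(c * t)) r = -(c * t) + r := hm2
  rw [hα1, hβ1, hα2, hβ2, integral_telegraphDensity_head,
    integral_telegraphDensity_tail hc hl₁ ht hr hr2]
  -- An atom always catches its own position, but not the opposite one: their distance `2ct` is not
  -- less than `r`. This is where the strict inequality matters at `r = 2ct`.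
  have i1 : c * t ∈ Set.Ioo (c * t - r) (c * t + 1) := ⟨by linarith, by linarith⟩
  have i2 : c * t ∉ Set.Ioo (-(c * t) - 1) (-(c * t) + r) := fun h => by linarith [h.2]
  have i3 : -(c * t) ∉ Set.Ioo (c * t - r) (c * t + 1) := fun h => by linarith [h.1]
  have i4 : -(c * t) ∈ Set.Ioo (-(c * t) - 1) (-(c * t) + r) := ⟨by linarith, by linarith⟩
  rw [Set.indicator_of_mem i1, Set.indicator_of_notMem i2, Set.indicator_of_notMem i3,
    Set.indicator_of_mem i4]
  ring

/-! ### The series -/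

/-- Only on the open interval: at `±ct` the quotient by the square root takes the default value `0`.
The integrals do not see the endpoints. -/
lemma integrandJ_eqOn (hc : 0 < c) (hl : 0 < lam) (ht : 0 < t) (k : ℕ) :
    Set.EqOn (integrandJ c lam k r t)
      (fun x => (beta c t x r * hyp k ((beta c t x r) ^ 2 / (c ^ 2 * t ^ 2))
        - alpha c t x r * hyp k ((alpha c t x r) ^ 2 / (c ^ 2 * t ^ 2)))
        * profile (lam * t) (1 - x ^ 2 / (c ^ 2 * t ^ 2)))
      (Set.uIoo (-(c * t)) (c * t)) := by
  have hct : 0 < c * t := by positivity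
  intro x hx
  rw [Set.uIoo_of_le (by linarith)] at hx
  have hlt : x ^ 2 < c ^ 2 * t ^ 2 := by
    rw [← mul_pow]
    exact sq_lt_sq' hx.1 hx.2
  have hu : 0 < 1 - x ^ 2 / (c ^ 2 * t ^ 2) := by
    rw [sub_pos, div_lt_one (by positivity)]
    exact hlt
  have hsq : √(c ^ 2 * t ^ 2 - x ^ 2) = c * t * √(1 - x ^ 2 / (c ^ 2 * t ^ 2)) := by
    rw [show c ^ 2 * t ^ 2 - x ^ 2 = (c * t) ^ 2 * (1 - x ^ 2 / (c ^ 2 * t ^ 2)) by field_simp,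
      Real.sqrt_mul (by positivity), Real.sqrt_sq hct.le]
  beta_reduce
  rw [integrandJ, hsq, ← besselI0_add_besselI1_eq_profile (b := lam * t) (by positivity) hu
    (one_sub_sq_div_mem hc ht ⟨hx.1.le, hx.2.le⟩).2]
  have e1 : lam / c * (c * t * √(1 - x ^ 2 / (c ^ 2 * t ^ 2)))
      = lam * t * √(1 - x ^ 2 / (c ^ 2 * t ^ 2)) := by field_simp
  have e2 : c * t / (c * t * √(1 - x ^ 2 / (c ^ 2 * t ^ 2)))
      = 1 / √(1 - x ^ 2 / (c ^ 2 * t ^ 2)) := by rw [← div_div, div_self hct.ne']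
  rw [e1, e2]

lemma continuous_hyp_window (k : ℕ) :
    Continuous fun x => beta c t x r * hyp k ((beta c t x r) ^ 2 / (c ^ 2 * t ^ 2))
        - alpha c t x r * hyp k ((alpha c t x r) ^ 2 / (c ^ 2 * t ^ 2)) := by
  have hα : Continuous fun x => alpha c t x r := by unfold alpha; fun_prop
  have hβ : Continuous fun x => beta c t x r := by unfold beta; fun_prop
  have := continuous_hyp k
  fun_prop

lemma intervalIntegrable_integrandJ (hc : 0 < c) (hl : 0 < lam) (ht : 0 < t) (k : ℕ) :
    IntervalIntegrable (integrandJ c lam k r t) volume (-(c * t)) (c * t) := by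
  have hct : 0 < c * t := by positivity
  rw [intervalIntegrable_congr_uIoo (integrandJ_eqOn hc hl ht k)]
  refine ContinuousOn.intervalIntegrable_of_Icc (by linarith)
    ((continuous_hyp_window k).continuousOn.mul ?_)
  exact (continuousOn_profile (b := lam * t) (by positivity)).comp (by fun_prop)
    fun x hx => one_sub_sq_div_mem hc ht hx

lemma integralJ_eq (hc : 0 < c) (hl : 0 < lam) (ht : 0 < t) (k : ℕ) :
    integralJ c lam k r t = ∫ x in (-(c * t))..(c * t), telegraphDensity c lam t x
      * (beta c t x r * hyp k ((beta c t x r) ^ 2 / (c ^ 2 * t ^ 2))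
        - alpha c t x r * hyp k ((alpha c t x r) ^ 2 / (c ^ 2 * t ^ 2))) := by
  rw [integralJ, intervalIntegral.integral_congr_uIoo (integrandJ_eqOn hc hl ht k),
    ← intervalIntegral.integral_const_mul]
  refine intervalIntegral.integral_congr fun x _ => ?_
  simp only [telegraphDensity]
  ring

lemma abs_mul_hyp_le (hc : 0 < c) (ht : 0 < t) {y : ℝ} (hy : y ∈ Set.Icc (-(c * t)) (c * t))
    (k : ℕ) : |y * hyp k (y ^ 2 / (c ^ 2 * t ^ 2))| ≤ c * t := by
  have h := one_sub_sq_div_mem hc ht hy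
  have h1 := abs_hyp_le_one k (z := y ^ 2 / (c ^ 2 * t ^ 2))
    ⟨by positivity, by linarith [h.1]⟩
  rw [abs_mul]
  calc |y| * |hyp k (y ^ 2 / (c ^ 2 * t ^ 2))| ≤ c * t * 1 := by
        gcongr
        exact abs_le.2 hy
    _ = c * t := mul_one _

/-- The inner integral is expanded into its series, and the sum leaves the outer integral by
dominated convergence, since each bracket in `alpha` and `beta` is at most `2ct` in absolute value.
-/
lemma hasSum_termB (hc : 0 < c) (hl₁ : 0 < lam₁) (hl₂ : 0 < lam₂) (ht : 0 < t) (hr : 0 < r) :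
    HasSum (fun k => lam₁ * Real.exp (-(lam₁ * t)) / (2 * c) * termB c lam₁ lam₂ r t k)
      (∫ x in (-(c * t))..(c * t), telegraphDensity c lam₂ t x
        * ∫ y in (alpha c t x r)..(beta c t x r), telegraphDensity c lam₁ t y) := by
  have hct : 0 < c * t := by positivity
  have hcct : -(c * t) ≤ c * t := by linarith
  have hsub : ∀ x ∈ Set.uIoc (-(c * t)) (c * t), x ∈ Set.Icc (-(c * t)) (c * t) := fun x hx => by
    rw [← Set.uIcc_of_le hcct]
    exact Set.uIoc_subset_uIcc hx
  have hl1 : 0 ≤ lam₁ * t := by positivity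
  have hterm : ∀ k, lam₁ * Real.exp (-(lam₁ * t)) / (2 * c) * termB c lam₁ lam₂ r t k
      = ∫ x in (-(c * t))..(c * t), telegraphDensity c lam₂ t x
        * (lam₁ * Real.exp (-(lam₁ * t)) / (2 * c) * (profileCoeff (lam₁ * t) k
        * (beta c t x r * hyp k ((beta c t x r) ^ 2 / (c ^ 2 * t ^ 2))
          - alpha c t x r * hyp k ((alpha c t x r) ^ 2 / (c ^ 2 * t ^ 2))))) := by
    intro k
    rw [termB, integralJ_eq hc hl₂ ht, ← intervalIntegral.integral_const_mul,
      ← intervalIntegral.integral_const_mul]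
    refine intervalIntegral.integral_congr fun x _ => ?_
    simp only [profileCoeff]
    ring
  simp_rw [hterm]
  have hdc := continuousOn_telegraphDensity hc hl₂ ht
  have hdi := intervalIntegrable_telegraphDensity hc hl₂ ht ⟨le_rfl, hcct⟩ ⟨hcct, le_rfl⟩
  refine intervalIntegral.hasSum_integral_of_dominated_convergence
    (fun k x => telegraphDensity c lam₂ t x * (lam₁ * Real.exp (-(lam₁ * t)) / (2 * c)
      * (profileCoeff (lam₁ * t) k * (c * t + c * t)))) ?_ ?_ ?_ ?_ ?_
  · intro k
    rw [Set.uIoc_of_le hcct]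
    exact (hdc.mono Set.Ioc_subset_Icc_self).aestronglyMeasurable measurableSet_Ioc |>.mul
      ((continuous_hyp_window k).const_mul _ |>.const_mul _).aestronglyMeasurable
  · refine fun k => ae_of_all _ fun x hx => ?_
    have hx' := hsub x hx
    have h0 := telegraphDensity_nonneg hc hl₂ ht hx'
    have h1 := profileCoeff_nonneg hl1 k
    rw [Real.norm_eq_abs, abs_mul, abs_mul, abs_mul, abs_of_nonneg h0, abs_of_nonneg h1,
      abs_of_nonneg (by positivity : 0 ≤ lam₁ * Real.exp (-(lam₁ * t)) / (2 * c))]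
    gcongr
    exact (abs_sub _ _).trans (add_le_add (abs_mul_hyp_le hc ht (beta_mem hc ht hr hx') k)
      (abs_mul_hyp_le hc ht (alpha_mem hc ht hr hx') k))
  · exact ae_of_all _ fun x _ =>
      (((summable_profileCoeff hl1).mul_right _).mul_left _).mul_left _
  · simp_rw [tsum_mul_left]
    exact hdi.mul_const _
  · refine ae_of_all _ fun x hx => ?_
    have hx' := hsub x hx
    exact (hasSum_integral_telegraphDensity hc hl₁ ht (alpha_mem hc ht hr hx')
      (beta_mem hc ht hr hx')).mul_left _

lemma termA_eq (k : ℕ) : termA c lam₁ lam₂ r t k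
    = lam₁ * t / 2 * profileCoeff (lam₁ * t) k * hyp k ((1 - r / (c * t)) ^ 2)
      + lam₂ * t / 2 * profileCoeff (lam₂ * t) k * hyp k ((1 - r / (c * t)) ^ 2) := by
  rw [termA, profileCoeff, profileCoeff]
  ring

lemma one_sub_div_sq_mem (hc : 0 < c) (ht : 0 < t) (hr : 0 < r) (hr2 : r ≤ 2 * c * t) :
    (1 - r / (c * t)) ^ 2 ∈ Set.Icc (0 : ℝ) 1 := by
  have hct : 0 < c * t := by positivity
  have h1 : 0 < r / (c * t) := by positivity
  have h2 : r / (c * t) ≤ 2 := by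
    rw [div_le_iff₀ hct]
    linarith
  refine ⟨sq_nonneg _, ?_⟩
  rw [sq_le_one_iff_abs_le_one, abs_le]
  constructor <;> linarith

lemma summable_termA (hc : 0 < c) (hl₁ : 0 < lam₁) (hl₂ : 0 < lam₂) (ht : 0 < t) (hr : 0 < r)
    (hr2 : r ≤ 2 * c * t) : Summable (termA c lam₁ lam₂ r t) := by
  have hs : ∀ l : ℝ, 0 < l → Summable fun k =>
      l * t / 2 * profileCoeff (l * t) k * hyp k ((1 - r / (c * t)) ^ 2) := fun l hl => by
    have hlt : 0 ≤ l * t := by positivity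
    refine Summable.of_norm_bounded ((summable_profileCoeff hlt).mul_left (l * t / 2))
      fun k => ?_
    have h0 := profileCoeff_nonneg hlt k
    rw [norm_mul, Real.norm_of_nonneg (by positivity)]
    exact mul_le_of_le_one_right (by positivity)
      (abs_hyp_le_one k (one_sub_div_sq_mem hc ht hr hr2))
  exact ((hs lam₁ hl₁).add (hs lam₂ hl₂)).congr fun k => (termA_eq k).symm

/-- Both mixed terms share the endpoint `ct - r = ct (1 - r/(ct))`. The factor `ct` turns the
constant `λ / (2c)` of the density into `λt / 2`, which raises the power from `2k` to `2k + 1`. -/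
lemma hasSum_termA (hc : 0 < c) (hl₁ : 0 < lam₁) (hl₂ : 0 < lam₂) (ht : 0 < t) (hr : 0 < r)
    (hr2 : r ≤ 2 * c * t) :
    HasSum (fun k => Real.exp (-((lam₁ + lam₂) * t)) * (1 - r / (c * t))
        * termA c lam₁ lam₂ r t k)
      (Real.exp (-(lam₂ * t)) * (∫ x in (0 : ℝ)..(c * t - r), telegraphDensity c lam₁ t x)
        + Real.exp (-(lam₁ * t)) * ∫ x in (0 : ℝ)..(c * t - r), telegraphDensity c lam₂ t x) := by
  have hct : 0 < c * t := by positivity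
  have m0 : (0 : ℝ) ∈ Set.Icc (-(c * t)) (c * t) := ⟨by linarith, hct.le⟩
  have m3 : c * t - r ∈ Set.Icc (-(c * t)) (c * t) := ⟨by linarith, by linarith⟩
  convert! ((hasSum_integral_telegraphDensity hc hl₁ ht m0 m3).mul_left
    (Real.exp (-(lam₂ * t)))).add ((hasSum_integral_telegraphDensity hc hl₂ ht m0 m3).mul_left
    (Real.exp (-(lam₁ * t)))) using 2 with k
  rw [termA_eq, show (c * t - r) ^ 2 / (c ^ 2 * t ^ 2) = (1 - r / (c * t)) ^ 2 by field_simp,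
    show -((lam₁ + lam₂) * t) = -(lam₁ * t) + -(lam₂ * t) by ring, Real.exp_add]
  field_simp
  ring

end Distance

/-! ### Support of the law and the conclusion. -/

lemma ae_abs_le {Ω : Type*} [MeasurableSpace Ω] {μ : Measure Ω} {c lam t : ℝ} (hc : 0 < c)
    (ht : 0 < t) {Y : Ω → ℝ} (hY : HasLaw Y (telegraphLaw c lam t) μ) :
    ∀ᵐ ω ∂μ, |Y ω| ≤ c * t := by
  have hct : 0 < c * t := by positivity
  have hm : Measurable fun x : ℝ => |x| ≤ c * t :=
    measurableSet_setOfPred.1 (measurableSet_le (by fun_prop) measurable_const)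
  rw [hY.ae_iff (p := fun x => |x| ≤ c * t) hm, telegraphLaw, ae_add_measure_iff]
  constructor
  · refine Measure.ae_smul_measure ?_ _
    rw [ae_add_measure_iff, ae_dirac_eq, ae_dirac_eq]
    simp [abs_of_pos hct]
  · refine (withDensity_absolutelyContinuous _ _).ae_le ?_
    filter_upwards [ae_restrict_mem measurableSet_Icc] with x hx using abs_le.2 hx

end Telegraph

theorem theorem2 {Ω : Type*} [MeasurableSpace Ω] (μ : Measure Ω) [IsProbabilityMeasure μ]
    (c : ℝ) (hc : 0 < c) (lam₁ lam₂ : ℝ≥0) (hlam₁ : 0 < lam₁) (hlam₂ : 0 < lam₂)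
    (X₁ X₂ : ℝ≥0 → Ω → ℝ)
    (hX₁ : Telegraph.IsTelegraphProcess c lam₁ X₁ μ)
    (hX₂ : Telegraph.IsTelegraphProcess c lam₂ X₂ μ)
    (hind : IndepFun (fun ω s => X₁ s ω) (fun ω s => X₂ s ω) μ)
    (t : ℝ≥0) (ht : 0 < t) (r : ℝ) :
    (r ≤ 0 → Telegraph.distanceCDF μ X₁ X₂ r t = 0) ∧
    (0 < r → r ≤ 2 * c * t →
      (∀ k : ℕ, IntervalIntegrable (Telegraph.integrandJ c lam₂ k r t) volume
        (-(c * t)) (c * t)) ∧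
      Summable (Telegraph.termA c lam₁ lam₂ r t) ∧
      Summable (Telegraph.termB c lam₁ lam₂ r t) ∧
      Telegraph.distanceCDF μ X₁ X₂ r t = Telegraph.H c lam₁ lam₂ r t) ∧
    (2 * c * t < r → Telegraph.distanceCDF μ X₁ X₂ r t = 1) := by
  have ht' : (0 : ℝ) < t := ht
  have hl₁ : (0 : ℝ) < lam₁ := hlam₁
  have hl₂ : (0 : ℝ) < lam₂ := hlam₂
  have hlaw₁ := hX₁.hasLaw hc hlam₁ ht
  have hlaw₂ := hX₂.hasLaw hc hlam₂ ht
  have hind' : IndepFun (X₁ t) (X₂ t) μ :=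
    hind.comp (measurable_pi_apply (X := fun _ : ℝ≥0 => ℝ) t)
      (measurable_pi_apply (X := fun _ : ℝ≥0 => ℝ) t)
  refine ⟨fun hr => ?_, fun hr hr2 => ?_, fun hr => ?_⟩
  · have : {ω | |X₁ t ω - X₂ t ω| < r} = ∅ :=
      Set.eq_empty_of_forall_notMem fun ω hω => absurd (lt_of_lt_of_le hω hr)
        (not_lt.2 (abs_nonneg _))
    rw [Telegraph.distanceCDF, this, measureReal_empty]
  · have hB := Telegraph.hasSum_termB hc hl₁ hl₂ ht' hr
    have hA := Telegraph.hasSum_termA hc hl₁ hl₂ ht' hr hr2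
    have hcoef : (lam₁ : ℝ) * Real.exp (-(lam₁ * t)) / (2 * c) ≠ 0 := by positivity
    refine ⟨fun k => Telegraph.intervalIntegrable_integrandJ hc hl₂ ht' k,
      Telegraph.summable_termA hc hl₁ hl₂ ht' hr hr2, (summable_mul_left_iff hcoef).1 hB.summable,
      ?_⟩
    have := Telegraph.isFiniteMeasure_telegraphLaw hc hl₁ ht'
    have := Telegraph.isFiniteMeasure_telegraphLaw hc hl₂ ht'
    obtain ⟨hmeas, heq⟩ := Telegraph.distanceCDF_eq_integral hlaw₁ hlaw₂ hind' r
    rw [heq, Telegraph.integral_telegraphLaw_real_Ioo hc hl₁ hl₂ ht' hr hr2 hmeas,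
      Telegraph.H, ← tsum_mul_left, hA.tsum_eq, ← hB.tsum_eq, tsum_mul_left,
      show -(((lam₁ : ℝ) + lam₂) * t) = -(lam₁ * t) + -(lam₂ * t) by ring, Real.exp_add]
    ring
  · have hae : ∀ᵐ ω ∂μ, |X₁ t ω - X₂ t ω| < r := by
      filter_upwards [Telegraph.ae_abs_le hc ht' hlaw₁, Telegraph.ae_abs_le hc ht' hlaw₂]
        with ω h₁ h₂
      linarith [abs_sub (X₁ t ω) (X₂ t ω)]
    exact (measureReal_congr (Filter.eventuallyEq_univ.2 hae)).trans probReal_univ
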